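/- **Theorem 1.** Let $q\in\mathbb C\setminus\{0\}$ not be a root of unity, and fix a square root of $q$, so that $q^{m}$ is defined for $m\in\frac12\mathbb Z$. Put $[a]=(q^a-q^{-a})/(q-q^{-1})$. Let $\hat U_q(\mathrm{sl}_2)^{\otimes 2,\mathrm{ext}}$ be the unital associative complex algebra generated by $e_i,f_i,q^{\pm H_i},x_i$ ($i=1,2$) and by elements $(q^{H_1\pm H_2+j}+q^{-H_1\mp H_2-j})^{-1}$ ($j\in\mathbb Z$) subject to the following relations. Firstly, $q^{H_i}q^{-H_i}=q^{-H_i}q^{H_i}=1$, $q^{H_i}e_i=q\,e_iq^{H_i}$, $q^{H_i}f_i=q^{-1}f_iq^{H_i}$, $[e_i,f_i]=(q^{2H_i}-q^{-2H_i})/(q-q^{-1})$. Secondly, $x_i$ commutes with $e_i,f_i,q^{\pm H_i}$ and $q^{-1}x_i^4-c_i(q-q^{-1})^2x_i^2+q=0$, where $c_i=e_if_i+(q^{2H_i-1}+q^{-2H_i+1})/(q-q^{-1})^2$. Thirdly, $e_1,f_1,q^{\pm H_1},x_1$ commute with $e_2,f_2,q^{\pm H_2},x_2$. Finally, the added elements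 commute with $q^{\pm H_1},q^{\pm H_2}$; each of them is inverse to the element indicated by its notation (where $q^{H_1\pm H_2+j}=q^jq^{H_1}q^{\pm H_2}$ and $q^{-H_1\mp H_2-j}=q^{-j}q^{-H_1}q^{\mp H_2}$); and moving such an element to the right past $e_i$ (resp. $f_i$) replaces $j$ by $j+\eta$ (resp. $j-\eta$), where $\eta=-1$ for $i=2$ and the elements with $H_1-H_2$, and $\eta=1$ otherwise. For $l\in\{0,\frac12,1,\frac32,\dots\}$ and $\varepsilon\in\{1,-1,\mathrm i,-\mathrm i\}$ let $T^{(\varepsilon)}_l$ be the representation of one copy (generators $e,f,q^{\pm H},x$) on the space with basis $|l,m\rangle$, $m=-l,-l+1,\dots,l$, given by $$q^H|l,m\rangle=\varepsilon q^m|l,m\rangle,\quad e|l,m\rangle=[l-m]\,|l,m+1\rangle,\quad f|l,m\rangle=\varepsilon^2[l+m]\,|l,m-1\rangle,\quad x=\xi\cdot 1,$$ with $\xi=q^{-l}$ if $\varepsilon=\pm1$ and $\xi=\mathrm i\,q^{-l}$ if $\varepsilon=\pm\mathrm i$. The other possible values of the scalar by which $x$ acts are $-\xi$, $\xi^{-1}q$,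 $-\xi^{-1}q$. 1. Call $(l,\varepsilon,l',\varepsilon')$ admissible if $\varepsilon,\varepsilon'\in\{\pm1\}$, or $\varepsilon,\varepsilon'\in\{\pm\mathrm i\}$, or one of $\varepsilon,\varepsilon'$ is in $\{\pm1\}$, the other in $\{\pm\mathrm i\}$, and $l+l'\notin\mathbb Z$. If $(l,\varepsilon,l',\varepsilon')$ is admissible, then $T^{(\varepsilon)}_l\otimes T^{(\varepsilon')}_{l'}$ (with the first copy acting on the first factor and the second copy on the second) extends uniquely to a representation of $\hat U_q(\mathrm{sl}_2)^{\otimes 2,\mathrm{ext}}$, and this representation is irreducible. If it is not admissible, there is no such extension. Both statements remain true if $x_1$, $x_2$ are given any other of their possible values. 2. Up to the values of the operators of $x_1^kx_2^s$, every irreducible finite dimensional complex representation of $\hat U_q(\mathrm{sl}_2)^{\otimes 2,\mathrm{ext}}$ is equivalent to one of these representations: it is equivalent to $T^{(\varepsilon)}_l\otimes T^{(\varepsilon')}_{l'}$ for some admissible $(l,\varepsilon,l',\varepsilon')$ by an isomorphism that intertwines the operators of all generators other than $x_1,x_2$, while $x_1$ and $x_2$ act by scalars that are among the four possible values belonging to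 $(l,\varepsilon)$ and $(l',\varepsilon')$. -/

import Mathlib

open scoped TensorProduct

noncomputable section

namespace QSl2

/-- Generators of one copy of the extended quantum algebra of sl(2):
`k` stands for `q^H`, `kInv` for `q^(-H)`, and `x` is the adjoined central element. -/
inductive Loc : Type
  | e | f | k | kInv | x

/-- Generators of the extended algebra: `loc i a` is the generator `a` of the copy `i`
(the first copy is `0`, the second copy is `1`), `dPlus j` is
`(q^(H_1 + H_2 + j) + q^(-H_1 - H_2 - j))⁻¹` and `dMinus j` is
`(q^(H_1 - H_2 + j) + q^(-H_1 + H_2 - j))⁻¹`. -/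
inductive Gen : Type
  | loc (i : Fin 2) (a : Loc)
  | dPlus (j : ℤ)
  | dMinus (j : ℤ)

/-- A generator as an element of the free algebra. -/
abbrev fr (g : Gen) : FreeAlgebra ℂ Gen := FreeAlgebra.ι ℂ g

/-- `e_i`, `f_i`, `q^(H_i)`, `q^(-H_i)`, `x_i` and the two families of adjoined inverses in the
free algebra. -/
abbrev fe (i : Fin 2) : FreeAlgebra ℂ Gen := fr (.loc i .e)
abbrev ff (i : Fin 2) : FreeAlgebra ℂ Gen := fr (.loc i .f)
abbrev fk (i : Fin 2) : FreeAlgebra ℂ Gen := fr (.loc i .k)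
abbrev fkInv (i : Fin 2) : FreeAlgebra ℂ Gen := fr (.loc i .kInv)
abbrev fx (i : Fin 2) : FreeAlgebra ℂ Gen := fr (.loc i .x)
abbrev fdPlus (j : ℤ) : FreeAlgebra ℂ Gen := fr (.dPlus j)
abbrev fdMinus (j : ℤ) : FreeAlgebra ℂ Gen := fr (.dMinus j)

/-- The Casimir element `c_i = e_i f_i + (q^(2 H_i - 1) + q^(-2 H_i + 1)) / (q - q⁻¹)^2`. -/
def casimir (q : ℂ) (i : Fin 2) : FreeAlgebra ℂ Gen :=
  fe i * ff i + ((q - q⁻¹) ^ 2)⁻¹ • (q⁻¹ • fk i ^ 2 + q • fkInv i ^ 2)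

/-- The sign `1` for the first copy and `-1` for the second one. -/
def sgn (i : Fin 2) : ℤ := if i = 0 then 1 else -1

/-- Defining relations of the extended algebra. -/
inductive Rel (q : ℂ) : FreeAlgebra ℂ Gen → FreeAlgebra ℂ Gen → Prop
  | k_kInv (i : Fin 2) : Rel q (fk i * fkInv i) 1
  | kInv_k (i : Fin 2) : Rel q (fkInv i * fk i) 1
  | k_e (i : Fin 2) : Rel q (fk i * fe i) (q • (fe i * fk i))
  | k_f (i : Fin 2) : Rel q (fk i * ff i) (q⁻¹ • (ff i * fk i))
  | e_f (i : Fin 2) :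
      Rel q (fe i * ff i - ff i * fe i) ((q - q⁻¹)⁻¹ • (fk i ^ 2 - fkInv i ^ 2))
  | x_comm (i : Fin 2) (a : Loc) : Rel q (fx i * fr (.loc i a)) (fr (.loc i a) * fx i)
  | x_pow (i : Fin 2) :
      Rel q (q⁻¹ • fx i ^ 4 - (q - q⁻¹) ^ 2 • (casimir q i * fx i ^ 2) + q • 1) 0
  | copies_comm (a b : Loc) :
      Rel q (fr (.loc 0 a) * fr (.loc 1 b)) (fr (.loc 1 b) * fr (.loc 0 a))
  | k_dPlus (i : Fin 2) (j : ℤ) : Rel q (fk i * fdPlus j) (fdPlus j * fk i)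
  | kInv_dPlus (i : Fin 2) (j : ℤ) : Rel q (fkInv i * fdPlus j) (fdPlus j * fkInv i)
  | k_dMinus (i : Fin 2) (j : ℤ) : Rel q (fk i * fdMinus j) (fdMinus j * fk i)
  | kInv_dMinus (i : Fin 2) (j : ℤ) : Rel q (fkInv i * fdMinus j) (fdMinus j * fkInv i)
  | dPlus_e (i : Fin 2) (j : ℤ) : Rel q (fdPlus j * fe i) (fe i * fdPlus (j + 1))
  | dPlus_f (i : Fin 2) (j : ℤ) : Rel q (fdPlus j * ff i) (ff i * fdPlus (j - 1))
  | dMinus_e (i : Fin 2) (j : ℤ) : Rel q (fdMinus j * fe i) (fe i * fdMinus (j + sgn i))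
  | dMinus_f (i : Fin 2) (j : ℤ) : Rel q (fdMinus j * ff i) (ff i * fdMinus (j - sgn i))
  | dPlus_inv (j : ℤ) :
      Rel q (fdPlus j * (q ^ j • (fk 0 * fk 1) + q ^ (-j) • (fkInv 0 * fkInv 1))) 1
  | dMinus_inv (j : ℤ) :
      Rel q (fdMinus j * (q ^ j • (fk 0 * fkInv 1) + q ^ (-j) • (fkInv 0 * fk 1))) 1

/-- The extended algebra: the associative unital complex algebra with the generators `Gen` and
the relations `Rel q`. -/
abbrev UExt (q : ℂ) : Type := RingQuot (Rel q)

/-- A generator as an element of the extended algebra. -/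
def gen (q : ℂ) (g : Gen) : UExt q := RingQuot.mkAlgHom ℂ (Rel q) (fr g)

/-- Irreducibility of a representation of an algebra: the space is nonzero and its only invariant
subspaces are `0` and the whole space. -/
def IsIrreducibleRep {A V : Type*} [Ring A] [Algebra ℂ A] [AddCommGroup V] [Module ℂ V]
    (ρ : A →ₐ[ℂ] Module.End ℂ V) : Prop :=
  Nontrivial V ∧
    ∀ W : Submodule ℂ V, (∀ a : A, ∀ w ∈ W, ρ a w ∈ W) → W = ⊥ ∨ W = ⊤

/-- The label `ε` of a representation: one of `1`, `-1`, `i`, `-i`. -/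
inductive Eps : Type
  | one | negOne | i | negI

namespace Eps

/-- The complex number `ε`. -/
def val : Eps → ℂ
  | one => 1
  | negOne => -1
  | i => Complex.I
  | negI => -Complex.I

/-- `ε` is one of `i`, `-i`. -/
def IsImag : Eps → Prop
  | one => False
  | negOne => False
  | i => True
  | negI => True

/-- The factor by which the action of `f` for the label `ε` differs from the one for `1`. -/
def fSign : Eps → ℂ
  | one => 1
  | negOne => 1
  | i => -1
  | negI => -1

/-- The factor by which the chosen value of `x` for the label `ε` differs from `q^(-l)`. -/
def xPhase : Eps → ℂ
  | one => 1
  | negOne => 1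
  | i => Complex.I
  | negI => Complex.I

end Eps

/-- The `q`-number `[a]` of an integer `a`. -/
def qNum (q : ℂ) (a : ℤ) : ℂ := (q ^ a - q ^ (-a)) / (q - q⁻¹)

/-- The space of spin `l = n / 2`; the basis vector of index `b` is `|l, m⟩` with `m = b - l`. -/
abbrev H (n : ℕ) : Type := Fin (n + 1) → ℂ

/-- The operators of the representation of spin `l = n / 2` with label `ε` in which `x` acts by
the scalar `ξ`. Here `r` is the fixed square root of `q`, so that `q^m = r^(2 m)` for half-integral
`m`; for the basis vector of index `b` we have `2 m = 2 b - n`, `l - m = n - b`, `l + m = b`. -/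
def spinOp (q r : ℂ) (n : ℕ) (ε : Eps) (ξ : ℂ) : Loc → Module.End ℂ (H n)
  | .e => Matrix.toLin' (Matrix.of fun a b : Fin (n + 1) =>
      if (a : ℕ) = (b : ℕ) + 1 then qNum q ((n : ℤ) - (b : ℕ)) else 0)
  | .f => Matrix.toLin' (Matrix.of fun a b : Fin (n + 1) =>
      if (b : ℕ) = (a : ℕ) + 1 then ε.fSign * qNum q ((b : ℕ) : ℤ) else 0)
  | .k => Matrix.toLin' (Matrix.diagonal fun b : Fin (n + 1) =>
      ε.val * r ^ (2 * ((b : ℕ) : ℤ) - n))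
  | .kInv => Matrix.toLin' (Matrix.diagonal fun b : Fin (n + 1) =>
      (ε.val * r ^ (2 * ((b : ℕ) : ℤ) - n))⁻¹)
  | .x => ξ • 1

/-- The chosen value of `x` in the representation of spin `n / 2` with label `ε`:
`q^(-l)` for `ε = ±1` and `i q^(-l)` for `ε = ±i`. -/
def xVal (r : ℂ) (n : ℕ) (ε : Eps) : ℂ := ε.xPhase * r ^ (-(n : ℤ))

/-- The four possible values of `x` in the representation of spin `n / 2` with label `ε`. -/
def xVals (q r : ℂ) (n : ℕ) (ε : Eps) : Set ℂ :=
  {xVal r n ε, -xVal r n ε, (xVal r n ε)⁻¹ * q, -((xVal r n ε)⁻¹ * q)}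

/-- `ρ` is a representation of the extended algebra on `H n ⊗ H n'` that extends the tensor product
of the representations of the two copies with spins `n / 2`, `n' / 2`, labels `ε`, `ε'` and values
`ξ`, `ξ'` of `x_1`, `x_2`. -/
def IsTensorRep (q r : ℂ) (n n' : ℕ) (ε ε' : Eps) (ξ ξ' : ℂ)
    (ρ : UExt q →ₐ[ℂ] Module.End ℂ (H n ⊗[ℂ] H n')) : Prop :=
  ∀ a : Loc,
    ρ (gen q (.loc 0 a)) = TensorProduct.map (spinOp q r n ε ξ a) LinearMap.id ∧
    ρ (gen q (.loc 1 a)) = TensorProduct.map LinearMap.id (spinOp q r n' ε' ξ' a)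

/-- Both labels are in `{1, -1}`, or both are in `{i, -i}`, or they are of different kinds and the
sum of the spins `n / 2 + n' / 2` is half-integral but not integral. -/
def Admissible (n n' : ℕ) (ε ε' : Eps) : Prop :=
  (¬ ε.IsImag ∧ ¬ ε'.IsImag) ∨ (ε.IsImag ∧ ε'.IsImag) ∨
    (¬ (ε.IsImag ↔ ε'.IsImag) ∧ Odd (n + n'))

end QSl2

end

/-! Part 1 rests on a computation with weights. On a product of basis vectors with indices `a`, `b`,
a denominator acts by `q^j ω + q^(-j) ω⁻¹`, where `ω` is the weight in the first factor times the
weight, or its inverse, in the second. This scalar vanishes exactly when `ω² q^(2j) = -1`, and `ω²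
q^(2j) = ε² ε'² q^s` with `s = (2a - n) ± (2b - n') + 2j` of the parity of `n + n'`. If `ε² ε'² =
1`, then `q^s = -1` would make `q` a root of unity. If `ε² ε'² = -1`, the condition is `s = 0`,
which can be met precisely when `n + n'` is even. So admissibility is invertibility of all
denominators on the tensor product (`fSign_mul_zpow_ne`, `exists_denPlus_eq_zero`). Once they are
invertible, the relations for the inverses follow from those of the two copies
(`PairRel.exists_lift`), and uniqueness of inverses gives uniqueness of the extension.
Irreducibility: the `f_i` lower any nonzero vector to a multiple of the lowest weight vector, from
which the `e_i` reach every basis vector (`tensorOp_irreducible`).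

For part 2, finite dimension and `q` not a root of unity give a common lowest weight vector `v`
(`PairRel.exists_lowest`) killed by some power of each `e_i`. Applying `f_i` to the first vanishing
power forces the weight to be `ε q^(-l)` with `ε^4 = 1` (`LocalRel.exists_eps`). The linear map from
the tensor product of spin spaces that sends the lowest weight vector to `v` then intertwines
everything except the `x_i` (`PairRel.pairRaise_intertwines`). It is bijective because both sides
are irreducible. The `x_i` are central, hence scalars by Schur's lemma, and their quartic relation
evaluated on `v` leaves four values. -/

noncomputable section

namespace QSl2

/-! ### Relations, invertible denominators and homomorphisms from the extended algebra -/

section Relations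

variable {A : Type*} [Ring A] [Algebra ℂ A]

/-- The relations of one copy of the extended algebra, for elements of an arbitrary algebra. -/
structure LocalRel (q : ℂ) (g : Loc → A) : Prop where
  k_kInv : g .k * g .kInv = 1
  kInv_k : g .kInv * g .k = 1
  k_e : g .k * g .e = q • (g .e * g .k)
  k_f : g .k * g .f = q⁻¹ • (g .f * g .k)
  e_f : g .e * g .f - g .f * g .e = (q - q⁻¹)⁻¹ • (g .k ^ 2 - g .kInv ^ 2)
  x_comm (a : Loc) : g .x * g a = g a * g .x
  x_pow : q⁻¹ • g .x ^ 4 - (q - q⁻¹) ^ 2 •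
    ((g .e * g .f + ((q - q⁻¹) ^ 2)⁻¹ • (q⁻¹ • g .k ^ 2 + q • g .kInv ^ 2)) * g .x ^ 2) + q • 1 = 0

theorem LocalRel.map {q : ℂ} {g : Loc → A} (h : LocalRel q g) {B : Type*} [Ring B] [Algebra ℂ B]
    (φ : A →ₐ[ℂ] B) : LocalRel q (fun a => φ (g a)) where
  k_kInv := by rw [← map_mul, h.k_kInv, map_one]
  kInv_k := by rw [← map_mul, h.kInv_k, map_one]
  k_e := by simp only [← map_mul, h.k_e, map_smul]
  k_f := by simp only [← map_mul, h.k_f, map_smul]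
  e_f := by simp only [← map_mul, ← map_sub, ← map_pow, h.e_f, ← map_smul]
  x_comm a := by simp only [← map_mul, h.x_comm]
  x_pow := by simpa using congrArg φ h.x_pow

theorem LocalRel.kInv_e {q : ℂ} (hq : q ≠ 0) {g : Loc → A} (h : LocalRel q g) :
    g .kInv * g .e = q⁻¹ • (g .e * g .kInv) := by
  have : g .kInv * (g .k * g .e) * g .kInv = q • (g .kInv * g .e * (g .k * g .kInv)) := by
    rw [h.k_e]; simp [mul_assoc]
  rw [← mul_assoc, h.kInv_k, h.k_kInv, mul_one, one_mul] at this
  rw [this, smul_smul, inv_mul_cancel₀ hq, one_smul]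

theorem LocalRel.kInv_f {q : ℂ} (hq : q ≠ 0) {g : Loc → A} (h : LocalRel q g) :
    g .kInv * g .f = q • (g .f * g .kInv) := by
  have : g .kInv * (g .k * g .f) * g .kInv = q⁻¹ • (g .kInv * g .f * (g .k * g .kInv)) := by
    rw [h.k_f]; simp [mul_assoc]
  rw [← mul_assoc, h.kInv_k, h.k_kInv, mul_one, one_mul] at this
  rw [this, smul_smul, mul_inv_cancel₀ hq, one_smul]

/-- The element `q^(H_1 + H_2 + j) + q^(-H_1 - H_2 - j)` of an algebra that contains two copies. -/
def denPlus (q : ℂ) (g : Fin 2 → Loc → A) (j : ℤ) : A :=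
  q ^ j • (g 0 .k * g 1 .k) + q ^ (-j) • (g 0 .kInv * g 1 .kInv)

/-- The element `q^(H_1 - H_2 + j) + q^(-H_1 + H_2 - j)` of an algebra that contains two copies. -/
def denMinus (q : ℂ) (g : Fin 2 → Loc → A) (j : ℤ) : A :=
  q ^ j • (g 0 .k * g 1 .kInv) + q ^ (-j) • (g 0 .kInv * g 1 .k)

/-- If `K e = α e K` and `L e = β e L` for commuting pairs, then products rescale accordingly. -/
theorem mul_mul_smul_left {K L e : A} {α : ℂ} (h : K * e = α • (e * K)) (hL : L * e = e * L) :
    K * L * e = α • (e * (K * L)) := by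
  rw [mul_assoc, hL, ← mul_assoc, h]; simp [mul_assoc]

theorem mul_mul_smul_right {K L e : A} {β : ℂ} (h : L * e = β • (e * L)) (hK : K * e = e * K) :
    K * L * e = β • (e * (K * L)) := by
  rw [mul_assoc, h, mul_smul_comm, ← mul_assoc, hK, mul_assoc]

/-- Passing `e` scales the two summands of a denominator by inverse powers of `q`, which is the same
as shifting `j` by `η`. The `SemiconjBy` form passes directly to inverses. -/
theorem semiconjBy_of_smul {q : ℂ} (hq : q ≠ 0) {M N e : A} {η : ℤ}
    (hM : M * e = q ^ η • (e * M)) (hN : N * e = q ^ (-η) • (e * N)) (j : ℤ) :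
    SemiconjBy e (q ^ (j + η) • M + q ^ (-(j + η)) • N) (q ^ j • M + q ^ (-j) • N) := by
  rw [SemiconjBy, add_mul, mul_add, smul_mul_assoc, smul_mul_assoc, hM, hN, smul_smul, smul_smul,
    ← zpow_add₀ hq, ← zpow_add₀ hq, mul_smul_comm, mul_smul_comm, neg_add]

/-- The relations of the two copies, including that they commute. -/
structure PairRel (q : ℂ) (g : Fin 2 → Loc → A) : Prop where
  local_rel (i : Fin 2) : LocalRel q (g i)
  comm (a b : Loc) : g 0 a * g 1 b = g 1 b * g 0 a

namespace PairRel

variable {q : ℂ} {g : Fin 2 → Loc → A}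

theorem denPlus_e (hq : q ≠ 0) (h : PairRel q g) (i : Fin 2) (j : ℤ) :
    SemiconjBy (g i .e) (denPlus q g (j + 1)) (denPlus q g j) := by
  have hk := (h.local_rel i).k_e
  have hl := (h.local_rel i).kInv_e hq
  apply semiconjBy_of_smul hq <;> simp only [zpow_one, zpow_neg]
  · fin_cases i
    · exact mul_mul_smul_left hk (h.comm _ _).symm
    · exact mul_mul_smul_right hk (h.comm _ _)
  · fin_cases i
    · exact mul_mul_smul_left hl (h.comm _ _).symm
    · exact mul_mul_smul_right hl (h.comm _ _)

theorem denPlus_f (hq : q ≠ 0) (h : PairRel q g) (i : Fin 2) (j : ℤ) :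
    SemiconjBy (g i .f) (denPlus q g (j - 1)) (denPlus q g j) := by
  have hk := (h.local_rel i).k_f
  have hl := (h.local_rel i).kInv_f hq
  apply semiconjBy_of_smul hq <;> simp only [zpow_one, zpow_neg, neg_neg]
  · fin_cases i
    · exact mul_mul_smul_left hk (h.comm _ _).symm
    · exact mul_mul_smul_right hk (h.comm _ _)
  · fin_cases i
    · exact mul_mul_smul_left hl (h.comm _ _).symm
    · exact mul_mul_smul_right hl (h.comm _ _)

theorem denMinus_e (hq : q ≠ 0) (h : PairRel q g) (i : Fin 2) (j : ℤ) :
    SemiconjBy (g i .e) (denMinus q g (j + sgn i)) (denMinus q g j) := by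
  have hk := (h.local_rel i).k_e
  have hl := (h.local_rel i).kInv_e hq
  fin_cases i <;> apply semiconjBy_of_smul hq <;> simp only [sgn, Fin.zero_eta, Fin.mk_one,
    if_true, one_ne_zero, if_false, zpow_one, zpow_neg, neg_neg]
  · exact mul_mul_smul_left hk (h.comm _ _).symm
  · exact mul_mul_smul_left hl (h.comm _ _).symm
  · exact mul_mul_smul_right hl (h.comm _ _)
  · exact mul_mul_smul_right hk (h.comm _ _)

theorem denMinus_f (hq : q ≠ 0) (h : PairRel q g) (i : Fin 2) (j : ℤ) :
    SemiconjBy (g i .f) (denMinus q g (j - sgn i)) (denMinus q g j) := by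
  have hk := (h.local_rel i).k_f
  have hl := (h.local_rel i).kInv_f hq
  rw [sub_eq_add_neg]
  fin_cases i <;> apply semiconjBy_of_smul hq <;> simp only [sgn, Fin.zero_eta, Fin.mk_one,
    if_true, one_ne_zero, if_false, zpow_one, zpow_neg, neg_neg]
  · exact mul_mul_smul_left hk (h.comm _ _).symm
  · exact mul_mul_smul_left hl (h.comm _ _).symm
  · exact mul_mul_smul_right hl (h.comm _ _)
  · exact mul_mul_smul_right hk (h.comm _ _)

/-- An element that commutes with all `q^(±H_i)` commutes with the denominators. -/
theorem commute_den {y : A}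
    (h : ∀ i, Commute y (g i .k) ∧ Commute y (g i .kInv)) (j : ℤ) :
    Commute y (denPlus q g j) ∧ Commute y (denMinus q g j) := by
  obtain ⟨⟨h1, h2⟩, h3, h4⟩ := And.intro (h 0) (h 1)
  exact ⟨((h1.mul_right h3).smul_right _).add_right ((h2.mul_right h4).smul_right _),
    ((h1.mul_right h4).smul_right _).add_right ((h2.mul_right h3).smul_right _)⟩

theorem cartan_comm (h : PairRel q g) (i i' : Fin 2) :
    (Commute (g i .k) (g i' .k) ∧ Commute (g i .k) (g i' .kInv)) ∧
    (Commute (g i .kInv) (g i' .k) ∧ Commute (g i .kInv) (g i' .kInv)) := by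
  have H : ∀ i, Commute (g i .k) (g i .kInv) := fun i =>
    (h.local_rel i).k_kInv.trans (h.local_rel i).kInv_k.symm
  fin_cases i <;> fin_cases i'
  · exact ⟨⟨Commute.refl _, H 0⟩, (H 0).symm, Commute.refl _⟩
  · exact ⟨⟨h.comm _ _, h.comm _ _⟩, h.comm _ _, h.comm _ _⟩
  · exact ⟨⟨(h.comm _ _).symm, (h.comm _ _).symm⟩, (h.comm _ _).symm, (h.comm _ _).symm⟩
  · exact ⟨⟨Commute.refl _, H 1⟩, (H 1).symm, Commute.refl _⟩

/-- Two commuting copies whose denominators are all invertible define a homomorphism from the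
extended algebra. -/
theorem exists_lift (hq : q ≠ 0) (h : PairRel q g) (hp : ∀ j, IsUnit (denPlus q g j))
    (hm : ∀ j, IsUnit (denMinus q g j)) :
    ∃ T : UExt q →ₐ[ℂ] A, ∀ i a, T (gen q (.loc i a)) = g i a := by
  choose p hp using hp
  choose m hm using hm
  let G : Gen → A
    | .loc i a => g i a
    | .dPlus j => ((p j)⁻¹ : Aˣ)
    | .dMinus j => ((m j)⁻¹ : Aˣ)
  have hk : ∀ i j, Commute (g i .k) (p j) ∧ Commute (g i .k) (m j) := fun i j => by
    rw [hp, hm]; exact commute_den (fun i' => (h.cartan_comm i i').1) j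
  have hl : ∀ i j, Commute (g i .kInv) (p j) ∧ Commute (g i .kInv) (m j) := fun i j => by
    rw [hp, hm]; exact commute_den (fun i' => (h.cartan_comm i i').2) j
  have key : ∀ ⦃x y⦄, Rel q x y → FreeAlgebra.lift ℂ G x = FreeAlgebra.lift ℂ G y := by
    intro x y hxy
    induction hxy with
    | k_kInv i => simpa [G] using (h.local_rel i).k_kInv
    | kInv_k i => simpa [G] using (h.local_rel i).kInv_k
    | k_e i => simpa [G] using (h.local_rel i).k_e
    | k_f i => simpa [G] using (h.local_rel i).k_f
    | e_f i => simpa [G] using (h.local_rel i).e_f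
    | x_comm i a => simpa [G] using (h.local_rel i).x_comm a
    | x_pow i => simpa [G, casimir] using (h.local_rel i).x_pow
    | copies_comm a b => simpa [G] using h.comm a b
    | k_dPlus i j => simpa [G] using (hk i j).1.units_inv_right.eq
    | kInv_dPlus i j => simpa [G] using (hl i j).1.units_inv_right.eq
    | k_dMinus i j => simpa [G] using (hk i j).2.units_inv_right.eq
    | kInv_dMinus i j => simpa [G] using (hl i j).2.units_inv_right.eq
    -- Semiconjugacy of two units by `e` or `f` carries over to their inverses; this is the required
    -- relation read from right to left.
    | dPlus_e i j =>
      have := h.denPlus_e hq i j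
      rw [← hp, ← hp] at this
      simpa [G] using this.units_inv_right.eq.symm
    | dPlus_f i j =>
      have := h.denPlus_f hq i j
      rw [← hp, ← hp] at this
      simpa [G] using this.units_inv_right.eq.symm
    | dMinus_e i j =>
      have := h.denMinus_e hq i j
      rw [← hm, ← hm] at this
      simpa [G] using this.units_inv_right.eq.symm
    | dMinus_f i j =>
      have := h.denMinus_f hq i j
      rw [← hm, ← hm] at this
      simpa [G] using this.units_inv_right.eq.symm
    | dPlus_inv j =>
      have := (p j).inv_mul
      rw [hp] at this
      simpa [G, denPlus] using this
    | dMinus_inv j =>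
      have := (m j).inv_mul
      rw [hm] at this
      simpa [G, denMinus] using this
  refine ⟨RingQuot.liftAlgHom ℂ ⟨FreeAlgebra.lift ℂ G, key⟩, fun i a => ?_⟩
  rw [gen, RingQuot.liftAlgHom_mkAlgHom_apply, FreeAlgebra.lift_ι_apply]

end PairRel

variable {q : ℂ}

/-- The images of the generators of the two copies. -/
abbrev copies (T : UExt q →ₐ[ℂ] A) (i : Fin 2) (a : Loc) : A := T (gen q (.loc i a))

theorem map_rel (T : UExt q →ₐ[ℂ] A) {x y : FreeAlgebra ℂ Gen} (h : Rel q x y) :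
    T (RingQuot.mkAlgHom ℂ (Rel q) x) = T (RingQuot.mkAlgHom ℂ (Rel q) y) :=
  congrArg T (RingQuot.mkAlgHom_rel ℂ h)

theorem pairRel_copies (T : UExt q →ₐ[ℂ] A) : PairRel q (copies T) where
  local_rel i :=
    { k_kInv := by simpa [gen, copies] using map_rel T (Rel.k_kInv i)
      kInv_k := by simpa [gen, copies] using map_rel T (Rel.kInv_k i)
      k_e := by simpa [gen, copies] using map_rel T (Rel.k_e i)
      k_f := by simpa [gen, copies] using map_rel T (Rel.k_f i)
      e_f := by simpa [gen, copies] using map_rel T (Rel.e_f i)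
      x_comm := fun a => by simpa [gen, copies] using map_rel T (Rel.x_comm i a)
      x_pow := by simpa [gen, copies, casimir] using map_rel T (Rel.x_pow i) }
  comm a b := by simpa [gen, copies] using map_rel T (Rel.copies_comm a b)

theorem dPlus_mul (T : UExt q →ₐ[ℂ] A) (j : ℤ) :
    T (gen q (.dPlus j)) * denPlus q (copies T) j = 1 := by
  simpa [gen, copies, denPlus] using map_rel T (Rel.dPlus_inv j)

theorem dMinus_mul (T : UExt q →ₐ[ℂ] A) (j : ℤ) :
    T (gen q (.dMinus j)) * denMinus q (copies T) j = 1 := by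
  simpa [gen, copies, denMinus] using map_rel T (Rel.dMinus_inv j)

/-- The relations contain only a left inverse; since it commutes with all `q^(±H_i)`, it commutes
with the denominator and is a right inverse too. -/
theorem mul_dPlus (T : UExt q →ₐ[ℂ] A) (j : ℤ) :
    denPlus q (copies T) j * T (gen q (.dPlus j)) = 1 := by
  rw [← dPlus_mul T j]
  refine (PairRel.commute_den (fun i => ⟨?_, ?_⟩) j).1.symm.eq
  · exact Eq.symm (by simpa [gen, copies] using map_rel T (Rel.k_dPlus i j))
  · exact Eq.symm (by simpa [gen, copies] using map_rel T (Rel.kInv_dPlus i j))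

theorem mul_dMinus (T : UExt q →ₐ[ℂ] A) (j : ℤ) :
    denMinus q (copies T) j * T (gen q (.dMinus j)) = 1 := by
  rw [← dMinus_mul T j]
  refine (PairRel.commute_den (fun i => ⟨?_, ?_⟩) j).2.symm.eq
  · exact Eq.symm (by simpa [gen, copies] using map_rel T (Rel.k_dMinus i j))
  · exact Eq.symm (by simpa [gen, copies] using map_rel T (Rel.kInv_dMinus i j))

/-- The images of the adjoined elements are inverses of expressions in the two copies, so they leave
no freedom. -/
theorem algHom_ext_copies {T T' : UExt q →ₐ[ℂ] A} (h : copies T = copies T') : T = T' := by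
  apply RingQuot.ringQuot_ext'
  apply FreeAlgebra.hom_ext
  funext g
  change T (gen q g) = T' (gen q g)
  cases g with
  | loc i a => exact congrFun (congrFun h i) a
  | dPlus j => exact left_inv_eq_right_inv (dPlus_mul T j) (h ▸ mul_dPlus T' j)
  | dMinus j => exact left_inv_eq_right_inv (dMinus_mul T j) (h ▸ mul_dMinus T' j)

/-- An element that commutes with the two copies commutes with everything. -/
theorem commute_gen (T : UExt q →ₐ[ℂ] A) {y : A} (h : ∀ i a, Commute y (copies T i a)) (g : Gen) :
    Commute y (T (gen q g)) := by
  have hd := PairRel.commute_den (q := q) (g := copies T) (y := y) (fun i => ⟨h i _, h i _⟩)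
  cases g with
  | loc i a => exact h i a
  | dPlus j =>
    exact Commute.units_inv_right (u := ⟨_, _, mul_dPlus T j, dPlus_mul T j⟩) (hd j).1
  | dMinus j =>
    exact Commute.units_inv_right (u := ⟨_, _, mul_dMinus T j, dMinus_mul T j⟩) (hd j).2

theorem commute_x (T : UExt q →ₐ[ℂ] A) (i : Fin 2) (g : Gen) :
    Commute (copies T i .x) (T (gen q g)) := by
  refine commute_gen T (fun i' a => ?_) g
  have h := pairRel_copies T
  fin_cases i <;> fin_cases i'
  · exact (h.local_rel 0).x_comm a
  · exact h.comm _ _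
  · exact (h.comm _ _).symm
  · exact (h.local_rel 1).x_comm a

end Relations

/-! ### Invariant subspaces and Schur's lemma -/

section Invariance

variable {q : ℂ} {V : Type*} [AddCommGroup V] [Module ℂ V]

theorem invariant_of_gen (ρ : UExt q →ₐ[ℂ] Module.End ℂ V) {W : Submodule ℂ V}
    (h : ∀ g, ∀ w ∈ W, ρ (gen q g) w ∈ W) (a : UExt q) : ∀ w ∈ W, ρ a w ∈ W := by
  obtain ⟨a, rfl⟩ := RingQuot.mkAlgHom_surjective ℂ (Rel q) a
  induction a using FreeAlgebra.induction with
  | grade0 c =>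
    intro w hw
    simpa [Algebra.algebraMap_eq_smul_one] using W.smul_mem c hw
  | grade1 g => exact h g
  | mul a b ha hb =>
    intro w hw
    simpa using ha _ (hb w hw)
  | add a b ha hb =>
    intro w hw
    simpa using W.add_mem (ha w hw) (hb w hw)

/-- `Z` is injective on `W`, hence maps `W` onto itself by finite dimension, and `D` undoes it
there. -/
theorem mem_of_inverse [FiniteDimensional ℂ V] {D Z : Module.End ℂ V} (hDZ : D * Z = 1)
    {W : Submodule ℂ V} (h : ∀ w ∈ W, Z w ∈ W) : ∀ w ∈ W, D w ∈ W := by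
  intro w hw
  have hinj : Function.Injective (Z.restrict h) := fun x y hxy => Subtype.ext <| by
    have := congrArg (fun z : W => D z) hxy
    simpa [← Module.End.mul_apply, hDZ] using this
  obtain ⟨w', hw'⟩ := LinearMap.injective_iff_surjective.mp hinj ⟨w, hw⟩
  have h1 : Z w' = w := congrArg Subtype.val hw'
  rw [← h1, ← Module.End.mul_apply, hDZ]
  exact w'.2

/-- In finite dimension, a subspace that is invariant under the two copies is invariant. -/
theorem invariant_of_copies [FiniteDimensional ℂ V] (ρ : UExt q →ₐ[ℂ] Module.End ℂ V)
    {W : Submodule ℂ V} (h : ∀ i a, ∀ w ∈ W, copies ρ i a w ∈ W) (a : UExt q) :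
    ∀ w ∈ W, ρ a w ∈ W := by
  refine invariant_of_gen ρ (fun g => ?_) a
  cases g with
  | loc i a => exact h i a
  | dPlus j =>
    refine mem_of_inverse (dPlus_mul ρ j) fun w hw => ?_
    exact W.add_mem (W.smul_mem _ (h _ _ _ (h _ _ _ hw))) (W.smul_mem _ (h _ _ _ (h _ _ _ hw)))
  | dMinus j =>
    refine mem_of_inverse (dMinus_mul ρ j) fun w hw => ?_
    exact W.add_mem (W.smul_mem _ (h _ _ _ (h _ _ _ hw))) (W.smul_mem _ (h _ _ _ (h _ _ _ hw)))

/-- Schur's lemma for the central elements `x_i`. -/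
theorem exists_x_eq_smul [FiniteDimensional ℂ V] (ρ : UExt q →ₐ[ℂ] Module.End ℂ V)
    (hρ : IsIrreducibleRep ρ) (i : Fin 2) : ∃ ξ : ℂ, ∀ v, copies ρ i .x v = ξ • v := by
  have := hρ.1
  obtain ⟨ξ, hξ⟩ := Module.End.exists_eigenvalue (copies ρ i .x)
  refine ⟨ξ, fun v => ?_⟩
  have hinv := hρ.2 (Module.End.eigenspace (copies ρ i .x) ξ) fun a => by
    refine invariant_of_gen ρ (fun g w hw => ?_) a
    rw [Module.End.mem_eigenspace_iff] at hw ⊢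
    rw [← Module.End.mul_apply, (commute_x ρ i g).eq, Module.End.mul_apply, hw, map_smul]
  rcases hinv with h | h
  · exact absurd h hξ
  · exact Module.End.mem_eigenspace_iff.mp (h ▸ Submodule.mem_top)

end Invariance

/-! ### Scalar identities, labels and values of `x` -/

section Scalars

variable {q : ℂ}

theorem zpow_ne_one_of_pow (hq : ∀ k : ℕ, 0 < k → q ^ k ≠ 1) {a : ℤ} (ha : a ≠ 0) : q ^ a ≠ 1 := by
  intro h
  have hpos := Int.natAbs_pos.mpr ha
  rcases Int.natAbs_eq a with h' | h' <;> rw [h'] at h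
  · exact hq _ hpos (by rwa [zpow_natCast] at h)
  · exact hq _ hpos (by rwa [zpow_neg, zpow_natCast, inv_eq_one] at h)

theorem sub_inv_ne_zero (hq0 : q ≠ 0) (hq : ∀ k : ℕ, 0 < k → q ^ k ≠ 1) : q - q⁻¹ ≠ 0 := by
  intro h
  apply hq 2 two_pos
  rw [sub_eq_zero] at h
  rw [sq]
  nth_rewrite 2 [h]
  exact mul_inv_cancel₀ hq0

@[simp] theorem qNum_zero : qNum q 0 = 0 := by simp [qNum]

theorem qNum_ne_zero (hq0 : q ≠ 0) (hq : ∀ k : ℕ, 0 < k → q ^ k ≠ 1) {a : ℤ} (ha : a ≠ 0) :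
    qNum q a ≠ 0 := by
  refine div_ne_zero (fun h => ?_) (sub_inv_ne_zero hq0 hq)
  rw [sub_eq_zero] at h
  refine zpow_ne_one_of_pow hq (a := a + a) (by omega) ?_
  rw [zpow_add₀ hq0]
  nth_rewrite 2 [h]
  rw [← zpow_add₀ hq0, add_neg_cancel, zpow_zero]

namespace Eps

/-- The relations between `e`, `f`, `x` involve `q^(±H)` and `x` only through even powers, so all
four labels are handled uniformly through the sign `fSign`, the common square of `val` and `xPhase`.
-/
theorem val_sq (ε : Eps) : ε.val ^ 2 = ε.fSign := by cases ε <;> simp [val, fSign]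

theorem xPhase_sq (ε : Eps) : ε.xPhase ^ 2 = ε.fSign := by cases ε <;> simp [xPhase, fSign]

theorem fSign_sq (ε : Eps) : ε.fSign ^ 2 = 1 := by cases ε <;> simp [fSign]

theorem fSign_ne_zero (ε : Eps) : ε.fSign ≠ 0 := by cases ε <;> simp [fSign]

theorem val_ne_zero (ε : Eps) : ε.val ≠ 0 := by cases ε <;> simp [val]

theorem xPhase_ne_zero (ε : Eps) : ε.xPhase ≠ 0 := by cases ε <;> simp [xPhase]

theorem inv_fSign (ε : Eps) : ε.fSign⁻¹ = ε.fSign := by cases ε <;> simp [fSign]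

theorem fSign_mul_fSign_of_iff {ε ε' : Eps} (h : ε.IsImag ↔ ε'.IsImag) :
    ε.fSign * ε'.fSign = 1 := by
  cases ε <;> cases ε' <;> simp_all [IsImag, fSign]

theorem fSign_mul_fSign_of_not_iff {ε ε' : Eps} (h : ¬ (ε.IsImag ↔ ε'.IsImag)) :
    ε.fSign * ε'.fSign = -1 := by
  cases ε <;> cases ε' <;> simp_all [IsImag, fSign]

theorem exists_val_eq {z : ℂ} (h : z ^ 4 = 1) : ∃ ε : Eps, ε.val = z := by
  have h' : (z - 1) * (z + 1) * ((z - Complex.I) * (z + Complex.I)) = 0 := by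
    linear_combination h - (z ^ 2 - 1) * Complex.I_sq
  simp only [mul_eq_zero, sub_eq_zero, add_eq_zero_iff_eq_neg] at h'
  rcases h' with (h' | h') | h' | h'
  · exact ⟨one, h'.symm⟩
  · exact ⟨negOne, h'.symm⟩
  · exact ⟨i, h'.symm⟩
  · exact ⟨negI, h'.symm⟩

end Eps

theorem admissible_iff (n n' : ℕ) (ε ε' : Eps) :
    Admissible n n' ε ε' ↔ ((ε.IsImag ↔ ε'.IsImag) ∨ Odd (n + n')) := by
  unfold Admissible; tauto

variable {r : ℂ}

theorem xVal_sq (hr : r ^ 2 = q) (n : ℕ) (ε : Eps) : xVal r n ε ^ 2 = ε.fSign * q ^ (-(n : ℤ)) := by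
  rw [xVal, mul_pow, ε.xPhase_sq, ← hr, ← zpow_natCast, ← zpow_natCast, ← zpow_mul, ← zpow_mul,
    mul_comm (-(n : ℤ))]

/-- The quartic is quadratic in `ξ²`, with roots `ε² q^(-n)` and `ε² q^(n+2)`. These are the squares
of `xVal` and of `xVal⁻¹ q`. -/
theorem mem_xVals_iff (hr : r ^ 2 = q) (hq0 : q ≠ 0) (n : ℕ) (ε : Eps) (ξ : ℂ) :
    ξ ∈ xVals q r n ε ↔
      q⁻¹ * ξ ^ 4 - ε.fSign * (q⁻¹ * q ^ (-(n : ℤ)) + q * q ^ (n : ℤ)) * ξ ^ 2 + q = 0 := by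
  have hr0 : r ≠ 0 := by rintro rfl; simp at hr; exact hq0 hr.symm
  have hx : xVal r n ε ≠ 0 := mul_ne_zero ε.xPhase_ne_zero (zpow_ne_zero _ hr0)
  have h1 := xVal_sq hr n ε
  have h2 : ((xVal r n ε)⁻¹ * q) ^ 2 = ε.fSign * q ^ (n : ℤ) * q ^ 2 := by
    rw [mul_pow, inv_pow, h1, mul_inv, ε.inv_fSign, zpow_neg, inv_inv]
  have h3 : q ^ (-(n : ℤ)) * q ^ (n : ℤ) = 1 := by
    rw [← zpow_add₀ hq0, neg_add_cancel, zpow_zero]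
  have key : q * (q⁻¹ * ξ ^ 4 - ε.fSign * (q⁻¹ * q ^ (-(n : ℤ)) + q * q ^ (n : ℤ)) * ξ ^ 2 + q) =
      (ξ - xVal r n ε) * (ξ + xVal r n ε) *
        ((ξ - (xVal r n ε)⁻¹ * q) * (ξ + (xVal r n ε)⁻¹ * q)) := by
    rw [mul_comm (ξ - xVal r n ε), mul_comm (ξ - (xVal r n ε)⁻¹ * q), ← sq_sub_sq, ← sq_sub_sq,
      h1, h2]
    linear_combination (ξ ^ 4 - ε.fSign * q ^ (-(n : ℤ)) * ξ ^ 2) * mul_inv_cancel₀ hq0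
      - q ^ 2 * h3 * ε.fSign ^ 2 - q ^ 2 * ε.fSign_sq
  rw [← mul_eq_zero_iff_left hq0, key]
  simp only [mul_eq_zero, sub_eq_zero, add_eq_zero_iff_eq_neg, xVals, Set.mem_insert_iff,
    Set.mem_singleton_iff, or_assoc]

/-- `q^j ω + q^(-j) ω⁻¹` vanishes only if `ω² q^(2j) = -1`. -/
theorem den_scalar_eq_zero_iff (hq0 : q ≠ 0) {ω : ℂ} (hω : ω ≠ 0) (j : ℤ) :
    q ^ j * ω + q ^ (-j) * ω⁻¹ = 0 ↔ ω ^ 2 * q ^ (2 * j) = -1 := by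
  have h1 : q ^ j ≠ 0 := zpow_ne_zero _ hq0
  rw [mul_comm 2 j, zpow_mul, zpow_neg]
  change _ ↔ ω ^ 2 * (q ^ j) ^ 2 = -1
  field_simp
  rw [eq_neg_iff_add_eq_zero]
  constructor <;> intro h <;> linear_combination h

theorem neg_one_ne_zpow (hq : ∀ k : ℕ, 0 < k → q ^ k ≠ 1) (a : ℤ) : q ^ a ≠ -1 := by
  intro h
  rcases eq_or_ne a 0 with rfl | ha
  · norm_num at h
  · refine zpow_ne_one_of_pow hq (a := a * 2) (by omega) ?_
    rw [zpow_mul, h]; norm_num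

end Scalars

/-! ### The spin representations of one copy -/

section Spin

variable {q r : ℂ} {n : ℕ} {ε : Eps} {ξ : ℂ}

/-- The basis vector of index `b` of the space of spin `n / 2`; it is `0` if `n < b`. -/
def spinVec (n b : ℕ) : H n := fun a => if (a : ℕ) = b then 1 else 0

theorem spinVec_eq_zero {b : ℕ} (h : n < b) : spinVec n b = 0 := by
  funext a
  have := a.2
  simp only [spinVec, Pi.zero_apply, ite_eq_right_iff]
  omega

theorem spinVec_eq_single (b : Fin (n + 1)) : spinVec n b = Pi.single b 1 := by
  funext a
  simp [spinVec, Pi.single_apply, Fin.ext_iff]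

theorem spin_ext {M : Type*} [AddCommGroup M] [Module ℂ M] {f g : H n →ₗ[ℂ] M}
    (h : ∀ b ≤ n, f (spinVec n b) = g (spinVec n b)) : f = g := by
  refine (Pi.basisFun ℂ (Fin (n + 1))).ext fun b => ?_
  rw [Pi.basisFun_apply, ← spinVec_eq_single]
  exact h b (by omega)

/-- No bound on `b` is needed: at `b = n` both the coefficient `[0]` and the vector of index `n + 1`
vanish. -/
theorem spinOp_e (b : ℕ) :
    spinOp q r n ε ξ .e (spinVec n b) = qNum q ((n : ℤ) - b) • spinVec n (b + 1) := by
  rcases lt_or_ge n b with h | h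
  · rw [spinVec_eq_zero h, spinVec_eq_zero (by omega), map_zero, smul_zero]
  · lift b to Fin (n + 1) using by omega
    rw [spinVec_eq_single, spinOp, Matrix.toLin'_apply, Matrix.mulVec_single_one]
    funext a
    simp [spinVec]

theorem spinOp_f_zero : spinOp q r n ε ξ .f (spinVec n 0) = 0 := by
  have : spinVec n 0 = Pi.single 0 1 := spinVec_eq_single 0
  rw [this, spinOp, Matrix.toLin'_apply, Matrix.mulVec_single_one]
  funext a
  simp

theorem spinOp_f_succ {b : ℕ} (h : b + 1 ≤ n) :
    spinOp q r n ε ξ .f (spinVec n (b + 1)) =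
      (ε.fSign * qNum q ((b : ℤ) + 1)) • spinVec n b := by
  have : spinVec n (b + 1) = Pi.single ⟨b + 1, by omega⟩ 1 := spinVec_eq_single ⟨b + 1, by omega⟩
  rw [this, spinOp, Matrix.toLin'_apply, Matrix.mulVec_single_one]
  funext a
  simp [spinVec, eq_comm]

theorem spinOp_k (b : ℕ) :
    spinOp q r n ε ξ .k (spinVec n b) = (ε.val * r ^ (2 * (b : ℤ) - n)) • spinVec n b := by
  rcases lt_or_ge n b with h | h
  · rw [spinVec_eq_zero h, map_zero, smul_zero]
  · lift b to Fin (n + 1) using by omega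
    rw [spinVec_eq_single, spinOp, Matrix.toLin'_apply]
    funext a
    simp [Matrix.mulVec_diagonal, Pi.single_apply]
    split_ifs with h <;> simp [h]

theorem spinOp_kInv (b : ℕ) :
    spinOp q r n ε ξ .kInv (spinVec n b) =
      (ε.val * r ^ (2 * (b : ℤ) - n))⁻¹ • spinVec n b := by
  rcases lt_or_ge n b with h | h
  · rw [spinVec_eq_zero h, map_zero, smul_zero]
  · lift b to Fin (n + 1) using by omega
    rw [spinVec_eq_single, spinOp, Matrix.toLin'_apply]
    funext a
    simp [Matrix.mulVec_diagonal, Pi.single_apply]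
    split_ifs with h <;> simp [h]

theorem spinOp_e_f {b : ℕ} (hb : b ≤ n) :
    spinOp q r n ε ξ .e (spinOp q r n ε ξ .f (spinVec n b)) =
      (ε.fSign * qNum q b * qNum q (n - b + 1)) • spinVec n b := by
  cases b with
  | zero => simp [spinOp_f_zero]
  | succ b =>
    rw [spinOp_f_succ hb, map_smul, spinOp_e, smul_smul]
    congr 3
    push_cast
    ring

theorem spinOp_f_e {b : ℕ} (hb : b ≤ n) :
    spinOp q r n ε ξ .f (spinOp q r n ε ξ .e (spinVec n b)) =
      (ε.fSign * qNum q (n - b) * qNum q (b + 1)) • spinVec n b := by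
  rw [spinOp_e, map_smul]
  rcases hb.eq_or_lt with rfl | hb
  · simp
  · rw [spinOp_f_succ hb, smul_smul]
    congr 1
    ring

theorem weight_sq (hr : r ^ 2 = q) (ε : Eps) (a : ℤ) :
    (ε.val * r ^ a) ^ 2 = ε.fSign * q ^ a := by
  rw [mul_pow, ε.val_sq, ← hr, ← zpow_natCast, ← zpow_natCast, ← zpow_mul, ← zpow_mul,
    mul_comm a]

theorem weight_inv_sq (hr : r ^ 2 = q) (ε : Eps) (a : ℤ) :
    ((ε.val * r ^ a)⁻¹) ^ 2 = ε.fSign * (q ^ a)⁻¹ := by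
  rw [inv_pow, weight_sq hr, mul_inv, ε.inv_fSign]

theorem qNum_commutator (hq0 : q ≠ 0) (hq : ∀ k : ℕ, 0 < k → q ^ k ≠ 1) (n b : ℤ) :
    qNum q b * qNum q (n - b + 1) - qNum q (n - b) * qNum q (b + 1) =
      (q - q⁻¹)⁻¹ * (q ^ (2 * b - n) - (q ^ (2 * b - n))⁻¹) := by
  have h := sub_inv_ne_zero hq0 hq
  have e1 : 2 * b - n = b - (n - b) := by ring
  generalize n - b = m at *
  rw [e1]
  have hb : q ^ b ≠ 0 := zpow_ne_zero _ hq0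
  have hm : q ^ m ≠ 0 := zpow_ne_zero _ hq0
  simp only [qNum, zpow_add₀ hq0, zpow_sub₀ hq0, neg_add, zpow_neg, zpow_one]
  rw [div_mul_div_comm, div_mul_div_comm, ← sub_div, div_eq_iff (mul_ne_zero h h),
    mul_comm (q - q⁻¹)⁻¹, mul_assoc, inv_mul_cancel_left₀ h]
  field_simp
  ring

/-- The right side is free of `b`: up to the sign `fSign` and the factor `(q - q⁻¹)²`, it is the
scalar by which the Casimir element acts. -/
theorem casimir_scalar (hq0 : q ≠ 0) (hq : ∀ k : ℕ, 0 < k → q ^ k ≠ 1) (n b : ℤ) :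
    (q - q⁻¹) ^ 2 * (qNum q b * qNum q (n - b + 1)) + q⁻¹ * q ^ (2 * b - n)
      + q * (q ^ (2 * b - n))⁻¹ = q⁻¹ * q ^ (-n) + q * q ^ n := by
  have h := sub_inv_ne_zero hq0 hq
  have e1 : 2 * b - n = b - (n - b) := by ring
  have e2 : n = (n - b) + b := by ring
  generalize n - b = m at *
  rw [e1, e2]
  have hb : q ^ b ≠ 0 := zpow_ne_zero _ hq0
  have hm : q ^ m ≠ 0 := zpow_ne_zero _ hq0
  simp only [qNum, zpow_add₀ hq0, zpow_sub₀ hq0, neg_add, zpow_neg, zpow_one]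
  rw [div_mul_div_comm, ← sq (q - q⁻¹), mul_div_cancel₀ _ (pow_ne_zero 2 h)]
  field_simp
  ring

theorem weight_ne_zero (hr : r ^ 2 = q) (hq0 : q ≠ 0) (ε : Eps) (a : ℤ) : ε.val * r ^ a ≠ 0 :=
  mul_ne_zero ε.val_ne_zero (zpow_ne_zero _ (by rintro rfl; simp at hr; exact hq0 hr.symm))

theorem weight_succ (hr : r ^ 2 = q) (hq0 : q ≠ 0) (ε : Eps) (n b : ℤ) :
    ε.val * r ^ (2 * (b + 1) - n) = q * (ε.val * r ^ (2 * b - n)) := by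
  have hr0 : r ≠ 0 := by rintro rfl; simp at hr; exact hq0 hr.symm
  rw [show 2 * (b + 1) - n = 2 + (2 * b - n) by ring, zpow_add₀ hr0, ← hr]
  norm_cast
  ring

theorem localRel_spinOp (hr : r ^ 2 = q) (hq0 : q ≠ 0) (hq : ∀ k : ℕ, 0 < k → q ^ k ≠ 1)
    (hξ : ξ ∈ xVals q r n ε) : LocalRel q (spinOp q r n ε ξ) where
  k_kInv := spin_ext fun b _ => by
    rw [Module.End.mul_apply, spinOp_kInv, map_smul, spinOp_k, smul_smul,
      inv_mul_cancel₀ (weight_ne_zero hr hq0 _ _), one_smul, Module.End.one_apply]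
  kInv_k := spin_ext fun b _ => by
    rw [Module.End.mul_apply, spinOp_k, map_smul, spinOp_kInv, smul_smul,
      mul_inv_cancel₀ (weight_ne_zero hr hq0 _ _), one_smul, Module.End.one_apply]
  k_e := spin_ext fun b _ => by
    rw [LinearMap.smul_apply, Module.End.mul_apply, Module.End.mul_apply, spinOp_k, spinOp_e,
      map_smul, map_smul, spinOp_k, spinOp_e, smul_smul, smul_smul, smul_smul]
    push_cast
    rw [weight_succ hr hq0]
    congr 1
    ring
  k_f := spin_ext fun b hb => by
    rw [LinearMap.smul_apply, Module.End.mul_apply, Module.End.mul_apply, spinOp_k, map_smul]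
    cases b with
    | zero => simp [spinOp_f_zero]
    | succ b =>
      rw [spinOp_f_succ hb, map_smul, spinOp_k, smul_smul, smul_smul, smul_smul]
      push_cast
      rw [weight_succ hr hq0]
      congr 1
      field_simp
  e_f := spin_ext fun b hb => by
    simp only [LinearMap.smul_apply, LinearMap.sub_apply, Module.End.mul_apply, sq]
    rw [spinOp_e_f hb, spinOp_f_e hb, spinOp_k, spinOp_kInv, map_smul, map_smul, spinOp_k,
      spinOp_kInv, smul_smul, smul_smul, ← sub_smul, ← sub_smul, smul_smul, ← sq, ← sq,
      weight_sq hr, weight_inv_sq hr]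
    congr 1
    linear_combination ε.fSign * qNum_commutator hq0 hq n b
  x_comm a := by rw [spinOp, smul_mul_assoc, mul_smul_comm, one_mul, mul_one]
  x_pow := spin_ext fun b hb => by
    have h := sub_inv_ne_zero hq0 hq
    have hx : ∀ k : ℕ, spinOp q r n ε ξ .x ^ k = ξ ^ k • 1 := fun k => by
      rw [spinOp, smul_pow, one_pow]
    rw [hx, hx]
    simp only [LinearMap.smul_apply, LinearMap.sub_apply, LinearMap.add_apply,
      Module.End.mul_apply, sq (spinOp _ _ _ _ _ _), Module.End.one_apply, map_smul,
      LinearMap.zero_apply]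
    rw [spinOp_e_f hb, spinOp_k, spinOp_kInv, map_smul, map_smul, spinOp_k, spinOp_kInv]
    simp only [smul_smul, ← add_smul, ← sub_smul]
    convert zero_smul ℂ _
    rw [← sq, ← sq, weight_sq hr, weight_inv_sq hr]
    -- The Casimir scalar turns the relation into the quartic for `ξ`; the last summand below
    -- cancels `(q - q⁻¹)²` against the inverse in the definition of the Casimir element.
    have hc := casimir_scalar hq0 hq n b
    have hm := (mem_xVals_iff hr hq0 n ε ξ).mp hξ
    linear_combination hm - ε.fSign * ξ ^ 2 * hc
      - ξ ^ 2 * ε.fSign * (q⁻¹ * q ^ (2 * (b : ℤ) - n) + q * (q ^ (2 * (b : ℤ) - n))⁻¹) *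
        mul_inv_cancel₀ (pow_ne_zero 2 h)

end Spin

/-! ### Tensor products: denominators, irreducibility, existence and uniqueness -/

section Tensor

variable {q r : ℂ} {n n' : ℕ} {ε ε' : Eps} {ξ ξ' : ℂ}

theorem tensor_spin_ext {M : Type*} [AddCommGroup M] [Module ℂ M] {f g : H n ⊗[ℂ] H n' →ₗ[ℂ] M}
    (h : ∀ a ≤ n, ∀ b ≤ n', f (spinVec n a ⊗ₜ spinVec n' b) = g (spinVec n a ⊗ₜ spinVec n' b)) :
    f = g := by
  apply TensorProduct.ext
  exact spin_ext fun a ha => spin_ext fun b hb => h a ha b hb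

theorem eq_top_of_spinVec_mem {W : Submodule ℂ (H n ⊗[ℂ] H n')}
    (h : ∀ a ≤ n, ∀ b ≤ n', spinVec n a ⊗ₜ spinVec n' b ∈ W) : W = ⊤ := by
  rw [← W.ker_mkQ, LinearMap.ker_eq_top]
  refine tensor_spin_ext fun a ha b hb => ?_
  simpa using h a ha b hb

theorem isUnit_of_diagonal {Z : Module.End ℂ (H n ⊗[ℂ] H n')} (z : ℕ → ℕ → ℂ)
    (h0 : ∀ a ≤ n, ∀ b ≤ n', z a b ≠ 0)
    (h : ∀ a ≤ n, ∀ b ≤ n',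
      Z (spinVec n a ⊗ₜ spinVec n' b) = z a b • (spinVec n a ⊗ₜ spinVec n' b)) : IsUnit Z := by
  rw [LinearMap.isUnit_iff_range_eq_top]
  refine eq_top_of_spinVec_mem fun a ha b hb => ⟨(z a b)⁻¹ • (spinVec n a ⊗ₜ spinVec n' b), ?_⟩
  rw [map_smul, h a ha b hb, smul_smul, inv_mul_cancel₀ (h0 a ha b hb), one_smul]

variable (q r n n' ε ε' ξ ξ') in
/-- The operators of the generators of the two copies on the tensor product of two spin
representations. -/
def tensorOp (i : Fin 2) (a : Loc) : Module.End ℂ (H n ⊗[ℂ] H n') :=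
  if i = 0 then TensorProduct.map (spinOp q r n ε ξ a) LinearMap.id
  else TensorProduct.map LinearMap.id (spinOp q r n' ε' ξ' a)

theorem tensorOp_zero (a : Loc) : tensorOp q r n n' ε ε' ξ ξ' 0 a =
    TensorProduct.map (spinOp q r n ε ξ a) LinearMap.id := rfl

theorem tensorOp_one (a : Loc) : tensorOp q r n n' ε ε' ξ ξ' 1 a =
    TensorProduct.map LinearMap.id (spinOp q r n' ε' ξ' a) := rfl

theorem isTensorRep_iff {T : UExt q →ₐ[ℂ] Module.End ℂ (H n ⊗[ℂ] H n')} :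
    IsTensorRep q r n n' ε ε' ξ ξ' T ↔ copies T = tensorOp q r n n' ε ε' ξ ξ' := by
  constructor
  · intro h
    funext i a
    fin_cases i
    · exact (h a).1
    · exact (h a).2
  · intro h a
    exact ⟨congrFun (congrFun h 0) a, congrFun (congrFun h 1) a⟩

theorem pairRel_tensorOp (hr : r ^ 2 = q) (hq0 : q ≠ 0) (hq : ∀ k : ℕ, 0 < k → q ^ k ≠ 1)
    (hξ : ξ ∈ xVals q r n ε) (hξ' : ξ' ∈ xVals q r n' ε') :
    PairRel q (tensorOp q r n n' ε ε' ξ ξ') where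
  local_rel i := by
    fin_cases i
    · exact (localRel_spinOp hr hq0 hq hξ).map (B := Module.End ℂ (H n ⊗[ℂ] H n'))
        (Module.End.rTensorAlgHom ℂ (H n) (H n'))
    · exact (localRel_spinOp hr hq0 hq hξ').map (B := Module.End ℂ (H n ⊗[ℂ] H n'))
        (Module.End.lTensorAlgHom ℂ (H n') (H n))
  comm a b := by
    rw [tensorOp_zero, tensorOp_one]
    exact TensorProduct.ext' fun x y => rfl

theorem denPlus_tensorOp (j : ℤ) (a b : ℕ) :
    denPlus q (tensorOp q r n n' ε ε' ξ ξ') j (spinVec n a ⊗ₜ spinVec n' b) =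
      (q ^ j * ((ε.val * r ^ (2 * (a : ℤ) - n)) * (ε'.val * r ^ (2 * (b : ℤ) - n'))) +
        q ^ (-j) * ((ε.val * r ^ (2 * (a : ℤ) - n)) * (ε'.val * r ^ (2 * (b : ℤ) - n')))⁻¹) •
      (spinVec n a ⊗ₜ spinVec n' b) := by
  simp only [denPlus, tensorOp_zero, tensorOp_one, LinearMap.add_apply, LinearMap.smul_apply,
    Module.End.mul_apply, TensorProduct.map_tmul, LinearMap.id_apply, spinOp_k, spinOp_kInv,
    TensorProduct.smul_tmul_smul, smul_smul, ← add_smul, mul_inv]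

theorem denMinus_tensorOp (j : ℤ) (a b : ℕ) :
    denMinus q (tensorOp q r n n' ε ε' ξ ξ') j (spinVec n a ⊗ₜ spinVec n' b) =
      (q ^ j * ((ε.val * r ^ (2 * (a : ℤ) - n)) * (ε'.val * r ^ (2 * (b : ℤ) - n'))⁻¹) +
        q ^ (-j) * ((ε.val * r ^ (2 * (a : ℤ) - n)) * (ε'.val * r ^ (2 * (b : ℤ) - n'))⁻¹)⁻¹) •
      (spinVec n a ⊗ₜ spinVec n' b) := by
  simp only [denMinus, tensorOp_zero, tensorOp_one, LinearMap.add_apply, LinearMap.smul_apply,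
    Module.End.mul_apply, TensorProduct.map_tmul, LinearMap.id_apply, spinOp_k, spinOp_kInv,
    TensorProduct.smul_tmul_smul, smul_smul, ← add_smul, mul_inv, inv_inv]

/-- For labels of the same kind the sign is `1`, and no power of `q` is `-1`. For different kinds it
is `-1`, and `q^t = 1` only for `t = 0`, which `ht` excludes. -/
theorem fSign_mul_zpow_ne (hq : ∀ k : ℕ, 0 < k → q ^ k ≠ 1) (h : Admissible n n' ε ε') {t : ℤ}
    (ht : Odd (n + n') → t ≠ 0) : ε.fSign * ε'.fSign * q ^ t ≠ -1 := by
  rw [admissible_iff] at h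
  by_cases hi : ε.IsImag ↔ ε'.IsImag
  · rw [Eps.fSign_mul_fSign_of_iff hi, one_mul]
    exact neg_one_ne_zpow hq t
  · rw [Eps.fSign_mul_fSign_of_not_iff hi, neg_one_mul, Ne, neg_inj]
    exact zpow_ne_one_of_pow hq (ht (h.resolve_left hi))

theorem isUnit_denPlus_tensorOp (hr : r ^ 2 = q) (hq0 : q ≠ 0)
    (hq : ∀ k : ℕ, 0 < k → q ^ k ≠ 1) (h : Admissible n n' ε ε') (j : ℤ) :
    IsUnit (denPlus q (tensorOp q r n n' ε ε' ξ ξ') j) := by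
  refine isUnit_of_diagonal _ (fun a _ b _ => ?_) fun a _ b _ => denPlus_tensorOp j a b
  rw [Ne, den_scalar_eq_zero_iff hq0
    (mul_ne_zero (weight_ne_zero hr hq0 _ _) (weight_ne_zero hr hq0 _ _)), mul_pow, weight_sq hr,
    weight_sq hr, mul_mul_mul_comm, mul_assoc (_ * _) (_ * _), ← zpow_add₀ hq0, ← zpow_add₀ hq0]
  -- The exponent `(2a - n) + (2b - n') + 2j` has the parity of `n + n'`, so it is nonzero when that
  -- sum is odd.
  refine fSign_mul_zpow_ne hq h fun ⟨m, hm⟩ => ?_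
  omega

theorem isUnit_denMinus_tensorOp (hr : r ^ 2 = q) (hq0 : q ≠ 0)
    (hq : ∀ k : ℕ, 0 < k → q ^ k ≠ 1) (h : Admissible n n' ε ε') (j : ℤ) :
    IsUnit (denMinus q (tensorOp q r n n' ε ε' ξ ξ') j) := by
  refine isUnit_of_diagonal _ (fun a _ b _ => ?_) fun a _ b _ => denMinus_tensorOp j a b
  rw [Ne, den_scalar_eq_zero_iff hq0
    (mul_ne_zero (weight_ne_zero hr hq0 _ _) (inv_ne_zero (weight_ne_zero hr hq0 _ _))), mul_pow,
    weight_sq hr, weight_inv_sq hr, mul_mul_mul_comm, mul_assoc (_ * _) (_ * _), ← zpow_neg,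
    ← zpow_add₀ hq0, ← zpow_add₀ hq0]
  refine fSign_mul_zpow_ne hq h fun ⟨m, hm⟩ => ?_
  omega

/-- If the labels are not admissible, some denominator annihilates the lowest weight vector. -/
theorem exists_denPlus_eq_zero (hr : r ^ 2 = q) (hq0 : q ≠ 0) (h : ¬ Admissible n n' ε ε') :
    ∃ j : ℤ, denPlus q (tensorOp q r n n' ε ε' ξ ξ') j (spinVec n 0 ⊗ₜ spinVec n' 0) = 0 := by
  rw [admissible_iff, not_or, Nat.not_odd_iff_even] at h
  obtain ⟨hi, m, hm⟩ := h
  -- With `n + n' = 2m`, the choice `j = m` makes the exponent of `q` on the lowest weight vector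
  -- zero.
  refine ⟨m, ?_⟩
  rw [denPlus_tensorOp, (den_scalar_eq_zero_iff hq0
    (mul_ne_zero (weight_ne_zero hr hq0 _ _) (weight_ne_zero hr hq0 _ _)) m).mpr, zero_smul]
  rw [mul_pow, weight_sq hr, weight_sq hr, mul_mul_mul_comm, mul_assoc (_ * _) (_ * _),
    ← zpow_add₀ hq0, ← zpow_add₀ hq0, Eps.fSign_mul_fSign_of_not_iff hi,
    show 2 * ((0 : ℕ) : ℤ) - n + (2 * ((0 : ℕ) : ℤ) - n') + 2 * m = 0 by push_cast; omega,
    zpow_zero, mul_one]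

/-- The coordinate of index `a` on the space of spin `n / 2`; it is `0` if `n < a`. -/
def spinCoord (n a : ℕ) : H n →ₗ[ℂ] ℂ :=
  if h : a < n + 1 then LinearMap.proj ⟨a, h⟩ else 0

theorem spinCoord_eq_zero {a : ℕ} (h : n < a) : spinCoord n a = 0 :=
  dif_neg (by omega)

theorem spinCoord_spinVec {a : ℕ} (h : a ≤ n) (b : ℕ) :
    spinCoord n a (spinVec n b) = if a = b then 1 else 0 := by
  rw [spinCoord, dif_pos (by omega)]; rfl

theorem spinCoord_f (a : ℕ) (v : H n) :
    spinCoord n a (spinOp q r n ε ξ .f v) =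
      ε.fSign * qNum q ((a : ℤ) + 1) * spinCoord n (a + 1) v := by
  suffices spinCoord n a ∘ₗ spinOp q r n ε ξ .f =
    (ε.fSign * qNum q ((a : ℤ) + 1)) • spinCoord n (a + 1) from LinearMap.congr_fun this v
  refine spin_ext fun b hb => ?_
  rw [LinearMap.comp_apply, LinearMap.smul_apply]
  cases b with
  | zero =>
    rw [spinOp_f_zero, map_zero]
    rcases lt_or_ge n (a + 1) with h | h
    · simp [spinCoord_eq_zero h]
    · simp [spinCoord_spinVec h]
  | succ b =>
    rw [spinOp_f_succ hb, map_smul]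
    rcases lt_or_ge n (a + 1) with h | h
    · rw [spinCoord_eq_zero h]
      rcases lt_or_ge n a with h' | h'
      · simp [spinCoord_eq_zero h']
      · rw [spinCoord_spinVec h', if_neg (by omega)]; simp
    · rw [spinCoord_spinVec h, spinCoord_spinVec (by omega)]
      by_cases hab : a = b
      · simp [hab]
      · simp [hab]

/-- The coordinate of index `(a, b)` on the tensor product of two spin spaces. -/
def tensorCoord (n n' a b : ℕ) : H n ⊗[ℂ] H n' →ₗ[ℂ] ℂ :=
  LinearMap.mul' ℂ ℂ ∘ₗ TensorProduct.map (spinCoord n a) (spinCoord n' b)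

theorem tensorCoord_tmul (a b : ℕ) (v : H n) (v' : H n') :
    tensorCoord n n' a b (v ⊗ₜ v') = spinCoord n a v * spinCoord n' b v' := rfl

theorem tensorCoord_f_zero (a b : ℕ) (w : H n ⊗[ℂ] H n') :
    tensorCoord n n' a b (tensorOp q r n n' ε ε' ξ ξ' 0 .f w) =
      ε.fSign * qNum q ((a : ℤ) + 1) * tensorCoord n n' (a + 1) b w := by
  induction w with
  | zero => simp
  | add w w' h h' => rw [map_add, map_add, map_add, h, h', mul_add]
  | tmul v v' =>
    rw [tensorOp_zero, TensorProduct.map_tmul, tensorCoord_tmul, tensorCoord_tmul, spinCoord_f,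
      LinearMap.id_apply, mul_assoc]

theorem tensorCoord_f_one (a b : ℕ) (w : H n ⊗[ℂ] H n') :
    tensorCoord n n' a b (tensorOp q r n n' ε ε' ξ ξ' 1 .f w) =
      ε'.fSign * qNum q ((b : ℤ) + 1) * tensorCoord n n' a (b + 1) w := by
  induction w with
  | zero => simp
  | add w w' h h' => rw [map_add, map_add, map_add, h, h', mul_add]
  | tmul v v' =>
    rw [tensorOp_one, TensorProduct.map_tmul, tensorCoord_tmul, tensorCoord_tmul, spinCoord_f,
      LinearMap.id_apply, mul_left_comm]

theorem sum_tensorCoord (w : H n ⊗[ℂ] H n') :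
    ∑ a ∈ Finset.range (n + 1), ∑ b ∈ Finset.range (n' + 1),
      tensorCoord n n' a b w • (spinVec n a ⊗ₜ[ℂ] spinVec n' b) = w := by
  suffices ∑ a ∈ Finset.range (n + 1), ∑ b ∈ Finset.range (n' + 1),
      (tensorCoord n n' a b).smulRight (spinVec n a ⊗ₜ[ℂ] spinVec n' b) = LinearMap.id by
    simpa using LinearMap.congr_fun this w
  refine tensor_spin_ext fun c hc d hd => ?_
  simp only [LinearMap.sum_apply, LinearMap.smulRight_apply, tensorCoord_tmul, LinearMap.id_apply]
  rw [Finset.sum_eq_single_of_mem c (by simp; omega),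
    Finset.sum_eq_single_of_mem d (by simp; omega)]
  · simp [spinCoord_spinVec hc, spinCoord_spinVec hd]
  · intro b hb hne
    rw [spinCoord_spinVec (n := n') (by simp at hb; omega)]
    simp [hne]
  · intro a ha hne
    refine Finset.sum_eq_zero fun b _ => ?_
    rw [spinCoord_spinVec (n := n) (by simp at ha; omega)]
    simp [hne]

theorem eq_zero_of_tensorCoord {w : H n ⊗[ℂ] H n'} (h : ∀ a b, tensorCoord n n' a b w = 0) :
    w = 0 := by
  rw [← sum_tensorCoord w]
  simp [h]

theorem spinVec_tmul_ne_zero : (spinVec n 0 ⊗ₜ[ℂ] spinVec n' 0 : H n ⊗[ℂ] H n') ≠ 0 := by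
  intro h
  have := congrArg (tensorCoord n n' 0 0) h
  simp [tensorCoord_tmul, spinCoord_spinVec] at this

instance : Nontrivial (H n ⊗[ℂ] H n') := ⟨_, _, spinVec_tmul_ne_zero⟩

/-- A subspace with a nonzero vector that is stable under both lowering operators contains the
lowest weight vector. -/
theorem lowest_mem (hq0 : q ≠ 0) (hq : ∀ k : ℕ, 0 < k → q ^ k ≠ 1)
    {W : Submodule ℂ (H n ⊗[ℂ] H n')}
    (hf : ∀ i, ∀ w ∈ W, tensorOp q r n n' ε ε' ξ ξ' i .f w ∈ W) (N : ℕ) :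
    ∀ w ∈ W, w ≠ 0 → (∀ a b, N ≤ a + b → tensorCoord n n' a b w = 0) →
      spinVec n 0 ⊗ₜ spinVec n' 0 ∈ W := by
  -- `N` bounds the degrees `a + b` of the nonzero coordinates of `w`; each `f_i` lowers this bound
  -- by one.
  induction N with
  | zero => exact fun w _ h0 hN => absurd (eq_zero_of_tensorCoord fun a b => hN a b (by omega)) h0
  | succ N ih =>
    intro w hw h0 hN
    by_cases h1 : tensorOp q r n n' ε ε' ξ ξ' 0 .f w = 0
    · by_cases h2 : tensorOp q r n n' ε ε' ξ ξ' 1 .f w = 0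
      -- If both `f_i` kill `w`, then `[a + 1] ≠ 0` and `[b + 1] ≠ 0` leave only the coordinate of
      -- index `(0, 0)`.
      · have hc1 : ∀ a b, tensorCoord n n' (a + 1) b w = 0 := fun a b => by
          have := tensorCoord_f_zero (q := q) (r := r) (ε := ε) (ε' := ε') (ξ := ξ) (ξ' := ξ') a b w
          rw [h1, map_zero, eq_comm] at this
          exact (mul_eq_zero_iff_left
            (mul_ne_zero ε.fSign_ne_zero (qNum_ne_zero hq0 hq (by omega)))).mp this
        have hc2 : ∀ a b, tensorCoord n n' a (b + 1) w = 0 := fun a b => by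
          have := tensorCoord_f_one (q := q) (r := r) (ε := ε) (ε' := ε') (ξ := ξ) (ξ' := ξ') a b w
          rw [h2, map_zero, eq_comm] at this
          exact (mul_eq_zero_iff_left
            (mul_ne_zero ε'.fSign_ne_zero (qNum_ne_zero hq0 hq (by omega)))).mp this
        have hw0 : w = tensorCoord n n' 0 0 w • (spinVec n 0 ⊗ₜ[ℂ] spinVec n' 0) := by
          conv_lhs => rw [← sum_tensorCoord w]
          rw [Finset.sum_range_succ', Finset.sum_range_succ']
          simp [hc1, hc2]
        have hne : tensorCoord n n' 0 0 w ≠ 0 := fun h => h0 (by rw [hw0, h, zero_smul])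
        rw [hw0] at hw
        exact (W.smul_mem_iff hne).mp hw
      · refine ih _ (hf 1 w hw) h2 fun a b hab => ?_
        rw [tensorCoord_f_one, hN _ _ (by omega), mul_zero]
    · refine ih _ (hf 0 w hw) h1 fun a b hab => ?_
      rw [tensorCoord_f_zero, hN _ _ (by omega), mul_zero]

/-- Lowering reaches the lowest weight vector, and raising from it meets only nonzero coefficients
`[n - a]`, `[n' - b]`. Admissibility is not needed, so the lemma also applies to the kernel of an
intertwiner before the tensor product is known to be a representation of the extended algebra. -/
theorem tensorOp_irreducible (hq0 : q ≠ 0) (hq : ∀ k : ℕ, 0 < k → q ^ k ≠ 1)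
    {W : Submodule ℂ (H n ⊗[ℂ] H n')}
    (he : ∀ i, ∀ w ∈ W, tensorOp q r n n' ε ε' ξ ξ' i .e w ∈ W)
    (hf : ∀ i, ∀ w ∈ W, tensorOp q r n n' ε ε' ξ ξ' i .f w ∈ W) : W = ⊥ ∨ W = ⊤ := by
  refine or_iff_not_imp_left.mpr fun hW => ?_
  obtain ⟨w, hw, h0⟩ := W.exists_mem_ne_zero_of_ne_bot hW
  have h00 := lowest_mem hq0 hq hf (n + n' + 1) w hw h0 fun a b hab => by
    have : n < a ∨ n' < b := by omega
    rcases this with h | h <;> simp [tensorCoord, spinCoord_eq_zero h]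
  have ha0 : ∀ a ≤ n, spinVec n a ⊗ₜ spinVec n' 0 ∈ W := by
    intro a
    induction a with
    | zero => exact fun _ => h00
    | succ a ih =>
      intro ha
      have := he 0 _ (ih (by omega))
      rw [tensorOp_zero, TensorProduct.map_tmul, spinOp_e, LinearMap.id_apply,
        ← TensorProduct.smul_tmul'] at this
      exact (W.smul_mem_iff (qNum_ne_zero hq0 hq (by omega))).mp this
  refine eq_top_of_spinVec_mem fun a ha b => ?_
  induction b with
  | zero => exact fun _ => ha0 a ha
  | succ b ih =>
    intro hb
    have := he 1 _ (ih (by omega))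
    rw [tensorOp_one, TensorProduct.map_tmul, spinOp_e, LinearMap.id_apply,
      TensorProduct.tmul_smul] at this
    exact (W.smul_mem_iff (qNum_ne_zero hq0 hq (by omega))).mp this

theorem exists_tensorRep (hr : r ^ 2 = q) (hq0 : q ≠ 0) (hq : ∀ k : ℕ, 0 < k → q ^ k ≠ 1)
    (h : Admissible n n' ε ε') (hξ : ξ ∈ xVals q r n ε) (hξ' : ξ' ∈ xVals q r n' ε') :
    ∃ T : UExt q →ₐ[ℂ] Module.End ℂ (H n ⊗[ℂ] H n'), IsTensorRep q r n n' ε ε' ξ ξ' T := by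
  obtain ⟨T, hT⟩ := (pairRel_tensorOp hr hq0 hq hξ hξ').exists_lift hq0
    (isUnit_denPlus_tensorOp hr hq0 hq h) (isUnit_denMinus_tensorOp hr hq0 hq h)
  exact ⟨T, isTensorRep_iff.mpr (funext fun i => funext fun a => hT i a)⟩

theorem IsTensorRep.irreducible (hq0 : q ≠ 0) (hq : ∀ k : ℕ, 0 < k → q ^ k ≠ 1)
    {T : UExt q →ₐ[ℂ] Module.End ℂ (H n ⊗[ℂ] H n')}
    (hT : IsTensorRep q r n n' ε ε' ξ ξ' T) : IsIrreducibleRep T := by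
  rw [isTensorRep_iff] at hT
  refine ⟨inferInstance, fun W hW => ?_⟩
  refine tensorOp_irreducible (r := r) (ε := ε) (ε' := ε') (ξ := ξ) (ξ' := ξ') hq0 hq
    (fun i => ?_) fun i => ?_ <;>
  · rw [← hT]
    exact hW _

theorem IsTensorRep.unique {T T' : UExt q →ₐ[ℂ] Module.End ℂ (H n ⊗[ℂ] H n')}
    (hT : IsTensorRep q r n n' ε ε' ξ ξ' T) (hT' : IsTensorRep q r n n' ε ε' ξ ξ' T') : T' = T :=
  algHom_ext_copies ((isTensorRep_iff.mp hT').trans (isTensorRep_iff.mp hT).symm)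

/-- Otherwise a denominator would kill the nonzero lowest weight vector while having a left inverse.
-/
theorem IsTensorRep.admissible (hr : r ^ 2 = q) (hq0 : q ≠ 0)
    {T : UExt q →ₐ[ℂ] Module.End ℂ (H n ⊗[ℂ] H n')}
    (hT : IsTensorRep q r n n' ε ε' ξ ξ' T) : Admissible n n' ε ε' := by
  by_contra h
  rw [isTensorRep_iff] at hT
  obtain ⟨j, hj⟩ := exists_denPlus_eq_zero (ξ := ξ) (ξ' := ξ') hr hq0 h
  rw [← hT] at hj
  have hD := dPlus_mul (A := Module.End ℂ (H n ⊗[ℂ] H n')) T j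
  have := LinearMap.congr_fun hD (spinVec n 0 ⊗ₜ spinVec n' 0)
  rw [Module.End.mul_apply, hj, map_zero] at this
  exact spinVec_tmul_ne_zero this.symm

end Tensor

/-! ### Lowest weight vectors and the maps they determine -/

section LowestWeight

variable {q r : ℂ} {V : Type*} [AddCommGroup V] [Module ℂ V]

theorem weight_pow {K B : Module.End ℂ V} {c lam : ℂ} (hKB : K * B = c • (B * K)) {v : V}
    (hv : K v = lam • v) (k : ℕ) : K ((B ^ k) v) = (c ^ k * lam) • (B ^ k) v := by
  induction k with
  | zero => simpa using hv
  | succ k ih =>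
    rw [pow_succ' B, Module.End.mul_apply, ← Module.End.mul_apply K, hKB, LinearMap.smul_apply,
      Module.End.mul_apply, ih, map_smul, smul_smul, pow_succ', mul_assoc]

/-- If no power killed `v`, the vectors `B^k v` would be eigenvectors of `K` with pairwise distinct
eigenvalues `c^k lam`, an infinite independent family. It serves for `e` with `c = q` and for `f`
with `c = q⁻¹`. -/
theorem exists_pow_ne_zero_and_pow_succ_eq_zero [FiniteDimensional ℂ V] {K B : Module.End ℂ V}
    {c lam : ℂ} (hc0 : c ≠ 0) (hc : ∀ k : ℕ, 0 < k → c ^ k ≠ 1) (hKB : K * B = c • (B * K))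
    (hlam : lam ≠ 0) {v : V} (hv0 : v ≠ 0) (hv : K v = lam • v) :
    ∃ N, (B ^ N) v ≠ 0 ∧ (B ^ (N + 1)) v = 0 := by
  have hex : ∃ k, (B ^ k) v = 0 := by
    by_contra! hne
    have hinj : Function.Injective fun k : ℕ => c ^ k * lam := by
      intro k l hkl
      replace hkl : c ^ k = c ^ l := mul_right_cancel₀ hlam hkl
      wlog hle : k ≤ l generalizing k l
      · exact (this hkl.symm (by omega)).symm
      obtain ⟨m, rfl⟩ := Nat.exists_eq_add_of_le hle
      rcases Nat.eq_zero_or_pos m with rfl | hm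
      · rfl
      · rw [pow_add, left_eq_mul₀ (pow_ne_zero _ hc0)] at hkl
        exact absurd hkl (hc m hm)
    have := (Module.End.eigenvectors_linearIndependent' K _ hinj (fun k => (B ^ k) v)
      fun k => ⟨Module.End.mem_eigenspace_iff.mpr (weight_pow hKB hv k), hne k⟩).finite
    exact not_finite ℕ
  classical
  cases hk : Nat.find hex with
  | zero =>
    have := Nat.find_spec hex
    rw [hk] at this
    exact absurd this hv0
  | succ N =>
    refine ⟨N, Nat.find_min hex (by omega), ?_⟩
    have := Nat.find_spec hex
    rwa [hk] at this

namespace LocalRel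

variable {g : Loc → Module.End ℂ V} {lam : ℂ} {u : V}

theorem kInv_weight (h : LocalRel q g) (hlam : lam ≠ 0) (hu : g .k u = lam • u) :
    g .kInv u = lam⁻¹ • u := by
  have := LinearMap.congr_fun h.kInv_k u
  rw [Module.End.mul_apply, hu, map_smul, Module.End.one_apply] at this
  rw [eq_inv_smul_iff₀ hlam, this]

theorem weight_ne_zero (h : LocalRel q g) (hu0 : u ≠ 0) (hu : g .k u = lam • u) : lam ≠ 0 := by
  rintro rfl
  have := LinearMap.congr_fun h.kInv_k u
  rw [Module.End.mul_apply, hu, map_smul, zero_smul] at this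
  exact hu0 this.symm

theorem f_e_apply (h : LocalRel q g) (hlam : lam ≠ 0) (hu : g .k u = lam • u) :
    g .f (g .e u) = g .e (g .f u) - ((q - q⁻¹)⁻¹ * (lam ^ 2 - lam⁻¹ ^ 2)) • u := by
  have hl := h.kInv_weight hlam hu
  have := LinearMap.congr_fun h.e_f u
  simp only [LinearMap.sub_apply, LinearMap.smul_apply, Module.End.mul_apply, sq (g _), hu, hl,
    map_smul, smul_smul, ← sub_smul] at this
  simp only [← sq] at this
  rw [← this]
  abel

/-- The action of `f` on the vectors obtained from a lowest weight vector by means of `e`. -/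
theorem f_e_pow (hq0 : q ≠ 0) (hq : ∀ k : ℕ, 0 < k → q ^ k ≠ 1) (h : LocalRel q g)
    (hlam : lam ≠ 0) (hu : g .k u = lam • u) (hf : g .f u = 0) (b : ℕ) :
    g .f ((g .e ^ (b + 1)) u) =
      (-(qNum q (b + 1) * ((lam ^ 2 * q ^ b - (lam ^ 2 * q ^ b)⁻¹) / (q - q⁻¹)))) •
        (g .e ^ b) u := by
  have hd := sub_inv_ne_zero hq0 hq
  induction b with
  | zero =>
    simp only [zero_add, pow_one, f_e_apply h hlam hu, hf, map_zero, zero_sub, pow_zero,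
      Module.End.one_apply, ← neg_smul, qNum, Nat.cast_zero, zpow_one, zpow_neg, mul_one,
      div_self hd, one_mul, inv_pow, div_eq_inv_mul]
  | succ b ih =>
    have hb : q ^ b ≠ 0 := pow_ne_zero _ hq0
    rw [pow_succ' (g .e) (b + 1), Module.End.mul_apply,
      f_e_apply h (mul_ne_zero (pow_ne_zero _ hq0) hlam) (weight_pow h.k_e hu (b + 1)), ih,
      map_smul, ← Module.End.mul_apply (g .e), ← pow_succ', ← sub_smul]
    congr 1
    push_cast
    simp only [qNum, neg_add, zpow_add₀ hq0, zpow_natCast, zpow_neg, zpow_one, pow_succ]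
    generalize q ^ b = Y at *
    rw [← mul_right_inj' (mul_ne_zero hd hd)]
    -- Denominators are cleared with `q - q⁻¹` kept as an opaque `d`, so that only powers of `q`
    -- remain to be inverted afterwards.
    have e1 : ∀ x y z d : ℂ, d ≠ 0 → d * d * (-(x / d * (y / d)) - d⁻¹ * z) = -(x * y) - d * z := by
      intro x y z d hd; field_simp
    have e2 : ∀ x y d : ℂ, d ≠ 0 → d * d * (-(x / d * (y / d))) = -(x * y) := by
      intro x y d hd; field_simp
    rw [e1 _ _ _ _ hd, e2 _ _ _ hd]
    field_simp
    ring

/-- Applying `f` to `e^(n+1) u = 0` gives a multiple of `e^n u ≠ 0`, so its coefficient vanishes.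
Since `[n + 1] ≠ 0`, this means `(lam² q^n)² = 1`, that is `(lam r^n)^4 = 1`. -/
theorem exists_eps (hr : r ^ 2 = q) (hq0 : q ≠ 0) (hq : ∀ k : ℕ, 0 < k → q ^ k ≠ 1)
    (h : LocalRel q g) (hlam : lam ≠ 0) (hu : g .k u = lam • u) (hf : g .f u = 0) {n : ℕ}
    (hn : (g .e ^ n) u ≠ 0) (hn' : (g .e ^ (n + 1)) u = 0) :
    ∃ ε : Eps, lam = ε.val * r ^ (-(n : ℤ)) := by
  have hr0 : r ≠ 0 := by rintro rfl; simp at hr; exact hq0 hr.symm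
  have h1 := f_e_pow hq0 hq h hlam hu hf n
  rw [hn', map_zero, eq_comm, smul_eq_zero, or_iff_left hn, neg_eq_zero,
    mul_eq_zero_iff_left (qNum_ne_zero hq0 hq (by omega)), div_eq_zero_iff,
    or_iff_left (sub_inv_ne_zero hq0 hq), sub_eq_zero] at h1
  have hne : lam ^ 2 * q ^ n ≠ 0 := mul_ne_zero (pow_ne_zero _ hlam) (pow_ne_zero _ hq0)
  have h2 : lam ^ 2 * q ^ n * (lam ^ 2 * q ^ n) = 1 := by
    nth_rewrite 2 [h1]
    exact mul_inv_cancel₀ hne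
  obtain ⟨ε, hε⟩ := Eps.exists_val_eq (z := lam * r ^ n) (by rw [← h2, ← hr]; ring)
  refine ⟨ε, ?_⟩
  rw [hε, zpow_neg, zpow_natCast, mul_inv_cancel_right₀ (pow_ne_zero _ hr0)]

/-- The possible values of `x` on a lowest weight vector. -/
theorem x_mem_xVals (hr : r ^ 2 = q) (hq0 : q ≠ 0) (hq : ∀ k : ℕ, 0 < k → q ^ k ≠ 1)
    (h : LocalRel q g) {n : ℕ} {ε : Eps} (hu0 : u ≠ 0)
    (hu : g .k u = (ε.val * r ^ (-(n : ℤ))) • u) (hf : g .f u = 0) {ξ : ℂ}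
    (hx : ∀ v, g .x v = ξ • v) : ξ ∈ xVals q r n ε := by
  have hd := sub_inv_ne_zero hq0 hq
  rw [mem_xVals_iff hr hq0]
  have hl := h.kInv_weight (QSl2.weight_ne_zero hr hq0 _ _) hu
  have hx' : g .x = ξ • 1 := LinearMap.ext hx
  have := LinearMap.congr_fun h.x_pow u
  simp only [hx', smul_pow, one_pow, LinearMap.sub_apply, LinearMap.add_apply,
    LinearMap.smul_apply, Module.End.mul_apply, sq (g _), hu, hl, hf, map_zero, map_smul, smul_smul,
    ← sub_smul, Module.End.one_apply, zero_add, ← add_smul, LinearMap.zero_apply,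
    smul_eq_zero, or_iff_left hu0] at this
  simp only [← sq] at this
  rw [weight_sq hr, weight_inv_sq hr, ← zpow_neg, neg_neg] at this
  linear_combination this + ξ ^ 2 * ε.fSign * (q⁻¹ * q ^ (-(n : ℤ)) + q * q ^ (n : ℤ)) *
    mul_inv_cancel₀ (pow_ne_zero 2 hd)

end LocalRel

/-- The operator valued map that sends the basis vectors of the space of spin `n / 2` to
normalized powers of `E`. -/
def raise (q : ℂ) (n : ℕ) (E : Module.End ℂ V) : H n →ₗ[ℂ] Module.End ℂ V :=
  ∑ b ∈ Finset.range (n + 1),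
    (spinCoord n b).smulRight ((∏ j ∈ Finset.range b, qNum q ((n : ℤ) - j))⁻¹ • E ^ b)

theorem raise_spinVec {n b : ℕ} (hb : b ≤ n) (E : Module.End ℂ V) :
    raise q n E (spinVec n b) = (∏ j ∈ Finset.range b, qNum q ((n : ℤ) - j))⁻¹ • E ^ b := by
  simp only [raise, LinearMap.sum_apply, LinearMap.smulRight_apply]
  rw [Finset.sum_eq_single_of_mem b (by simp; omega)]
  · simp [spinCoord_spinVec hb]
  · intro a ha hne
    rw [spinCoord_spinVec (by simp at ha; omega)]
    simp [hne]

/-- The values of `raise` are polynomials in `E`; being operators rather than vectors, they can be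
moved past the other copy. -/
theorem commute_raise {X E : Module.End ℂ V} (h : Commute X E) {n : ℕ} (v : H n) :
    Commute X (raise q n E v) := by
  simp only [raise, LinearMap.sum_apply, LinearMap.smulRight_apply]
  exact Commute.sum_right _ _ _ fun b _ => ((h.pow_right b).smul_right _).smul_right _

/-- The vectors obtained from a lowest weight vector span a quotient of a spin representation. -/
theorem LocalRel.raise_intertwines {g : Loc → Module.End ℂ V} (hr : r ^ 2 = q) (hq0 : q ≠ 0)
    (hq : ∀ k : ℕ, 0 < k → q ^ k ≠ 1) (h : LocalRel q g) {n : ℕ} {ε : Eps} {u : V}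
    (hu : g .k u = (ε.val * r ^ (-(n : ℤ))) • u) (hf : g .f u = 0)
    (he : (g .e ^ (n + 1)) u = 0) (ξ : ℂ) {a : Loc} (ha : a ≠ .x) (v : H n) :
    raise q n (g .e) (spinOp q r n ε ξ a v) u = g a (raise q n (g .e) v u) := by
  have hr0 : r ≠ 0 := by rintro rfl; simp at hr; exact hq0 hr.symm
  have hd := sub_inv_ne_zero hq0 hq
  have hw : ∀ b : ℕ, ε.val * r ^ (2 * (b : ℤ) - n) = q ^ b * (ε.val * r ^ (-(n : ℤ))) := by
    intro b
    rw [sub_eq_add_neg, zpow_add₀ hr0, zpow_mul, ← hr, zpow_natCast]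
    norm_cast
    ring
  have hlam := QSl2.weight_ne_zero hr hq0 ε (-(n : ℤ))
  have hk : ∀ b : ℕ, g .k ((g .e ^ b) u) = (ε.val * r ^ (2 * (b : ℤ) - n)) • (g .e ^ b) u :=
    fun b => by rw [hw]; exact weight_pow h.k_e hu b
  suffices (raise q n (g .e)).flip u ∘ₗ spinOp q r n ε ξ a = g a ∘ₗ (raise q n (g .e)).flip u from
    LinearMap.congr_fun this v
  refine spin_ext fun b hb => ?_
  change raise q n (g .e) (spinOp q r n ε ξ a (spinVec n b)) u =
    g a (raise q n (g .e) (spinVec n b) u)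
  rw [raise_spinVec hb, LinearMap.smul_apply, map_smul]
  cases a with
  | x => exact absurd rfl ha
  | k => rw [spinOp_k, map_smul, raise_spinVec hb, LinearMap.smul_apply, LinearMap.smul_apply,
      hk, smul_comm]
  | kInv =>
    rw [spinOp_kInv, map_smul, raise_spinVec hb, LinearMap.smul_apply, LinearMap.smul_apply,
      h.kInv_weight (QSl2.weight_ne_zero hr hq0 _ _) (hk b), smul_comm]
  | e =>
    rw [spinOp_e, map_smul, LinearMap.smul_apply, ← Module.End.mul_apply, ← pow_succ']
    -- At the top, `[0] = 0` matches `e^(n+1) u = 0`. Below it, the new factor of the normalizing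
    -- product cancels the coefficient `[n - b]`.
    rcases hb.eq_or_lt with rfl | hb
    · rw [he, sub_self, qNum_zero, zero_smul, smul_zero]
    · rw [raise_spinVec hb, LinearMap.smul_apply, smul_smul, Finset.prod_range_succ, mul_inv,
        mul_left_comm, mul_inv_cancel₀ (qNum_ne_zero hq0 hq (by omega)), mul_one]
  | f =>
    cases b with
    | zero => rw [spinOp_f_zero, map_zero, LinearMap.zero_apply, pow_zero, Module.End.one_apply, hf,
        smul_zero]
    | succ b =>
      have hqb : q ^ b ≠ 0 := pow_ne_zero _ hq0
      have hqn : q ^ n ≠ 0 := pow_ne_zero _ hq0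
      -- This is the second factor in `f_e_pow` after inserting `lam² = ε² q^(-n)`.
      have hs : -((ε.fSign * q ^ (-(n : ℤ)) * q ^ b - (ε.fSign * q ^ (-(n : ℤ)) * q ^ b)⁻¹) /
          (q - q⁻¹)) = ε.fSign * qNum q ((n : ℤ) - b) := by
        rw [qNum, neg_sub, zpow_sub₀ hq0, zpow_sub₀ hq0, zpow_neg, mul_inv, mul_inv, ε.inv_fSign,
          inv_inv, zpow_natCast, zpow_natCast, ← neg_div, ← mul_div_assoc]
        congr 1
        field_simp
        ring
      rw [spinOp_f_succ hb, map_smul, raise_spinVec (by omega), LinearMap.smul_apply,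
        LinearMap.smul_apply, LocalRel.f_e_pow hq0 hq h hlam hu hf, smul_smul, smul_smul,
        Finset.prod_range_succ, weight_sq hr, ← mul_neg, hs, mul_inv]
      have hne := qNum_ne_zero hq0 hq (show (n : ℤ) - b ≠ 0 by omega)
      congr 1
      field_simp

/-- Two commuting copies have a common lowest weight vector. -/
theorem PairRel.exists_lowest [FiniteDimensional ℂ V] [Nontrivial V] (hq0 : q ≠ 0)
    (hq : ∀ k : ℕ, 0 < k → q ^ k ≠ 1) {g : Fin 2 → Loc → Module.End ℂ V} (h : PairRel q g) :
    ∃ (v : V) (lam : Fin 2 → ℂ), v ≠ 0 ∧ ∀ i, g i .k v = lam i • v ∧ g i .f v = 0 := by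
  have hq' : ∀ k : ℕ, 0 < k → q⁻¹ ^ k ≠ 1 := fun k hk hk' =>
    hq k hk (by rwa [inv_pow, inv_eq_one] at hk')
  -- A common eigenvector of both `q^(H_i)` is lowered by `f_1` as far as possible, then by `f_2`;
  -- since the copies commute, the second lowering keeps the result killed by `f_1`.
  obtain ⟨lam, hlam⟩ := Module.End.exists_eigenvalue (g 0 .k)
  have hinv : ∀ w ∈ Module.End.eigenspace (g 0 .k) lam,
      g 1 .k w ∈ Module.End.eigenspace (g 0 .k) lam := fun w hw => by
    rw [Module.End.mem_eigenspace_iff] at hw ⊢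
    rw [← Module.End.mul_apply, h.comm, Module.End.mul_apply, hw, map_smul]
  have : Nontrivial (Module.End.eigenspace (g 0 .k) lam) :=
    Submodule.nontrivial_iff_ne_bot.mpr hlam
  obtain ⟨lam', hlam'⟩ := Module.End.exists_eigenvalue ((g 1 .k).restrict hinv)
  obtain ⟨⟨v, hv⟩, hv', hv0⟩ := hlam'.exists_hasEigenvector
  rw [Module.End.mem_eigenspace_iff] at hv hv'
  replace hv' : g 1 .k v = lam' • v := congrArg Subtype.val hv'
  replace hv0 : v ≠ 0 := fun h0 => hv0 (Subtype.ext h0)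
  obtain ⟨N, hN, hN'⟩ := exists_pow_ne_zero_and_pow_succ_eq_zero (inv_ne_zero hq0) hq'
    (h.local_rel 0).k_f ((h.local_rel 0).weight_ne_zero hv0 hv) hv0 hv
  have hv1 := weight_pow (h.local_rel 0).k_f hv N
  have hv1' : g 1 .k ((g 0 .f ^ N) v) = lam' • (g 0 .f ^ N) v := by
    have : Commute (g 1 .k) (g 0 .f ^ N) := Commute.pow_right (h.comm _ _).symm N
    rw [← Module.End.mul_apply, this.eq, Module.End.mul_apply, hv', map_smul]
  rw [pow_succ', Module.End.mul_apply] at hN'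
  generalize (g 0 .f ^ N) v = w at *
  obtain ⟨N', hM, hM'⟩ := exists_pow_ne_zero_and_pow_succ_eq_zero (inv_ne_zero hq0) hq'
    (h.local_rel 1).k_f ((h.local_rel 1).weight_ne_zero hN hv1') hN hv1'
  have hcomm : ∀ a, Commute (g 0 a) (g 1 .f ^ N') := fun a => Commute.pow_right (h.comm _ _) _
  rw [pow_succ', Module.End.mul_apply] at hM'
  refine ⟨(g 1 .f ^ N') w, ![q⁻¹ ^ N * lam, q⁻¹ ^ N' * lam'], hM, Fin.forall_fin_two.mpr
    ⟨⟨?_, ?_⟩, weight_pow (h.local_rel 1).k_f hv1' N', hM'⟩⟩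
  · rw [← Module.End.mul_apply, (hcomm _).eq, Module.End.mul_apply, hv1, map_smul]
    rfl
  · rw [← Module.End.mul_apply, (hcomm _).eq, Module.End.mul_apply, hN', map_zero]

/-- The map from a tensor product of spin spaces that is determined by the image of the lowest
weight vector. -/
def pairRaise (q : ℂ) (n n' : ℕ) (E E' : Module.End ℂ V) (v : V) : H n ⊗[ℂ] H n' →ₗ[ℂ] V :=
  TensorProduct.lift <| LinearMap.mk₂ ℂ (fun x y => raise q n E x (raise q n' E' y v))
    (by simp) (by simp) (by simp) (by simp)

theorem pairRaise_tmul (n n' : ℕ) (E E' : Module.End ℂ V) (v : V) (x : H n) (y : H n') :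
    pairRaise q n n' E E' v (x ⊗ₜ y) = raise q n E x (raise q n' E' y v) := rfl

/-- For the first copy, the vector already raised by the second copy is again a lowest weight vector
of the same weight. For the second copy, its operators are moved past the polynomial in `e_1`. -/
theorem PairRel.pairRaise_intertwines {g : Fin 2 → Loc → Module.End ℂ V} (hr : r ^ 2 = q)
    (hq0 : q ≠ 0) (hq : ∀ k : ℕ, 0 < k → q ^ k ≠ 1) (h : PairRel q g) {n n' : ℕ} {ε ε' : Eps}
    {v : V} (hk : g 0 .k v = (ε.val * r ^ (-(n : ℤ))) • v)
    (hk' : g 1 .k v = (ε'.val * r ^ (-(n' : ℤ))) • v) (hf : ∀ i, g i .f v = 0)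
    (he : (g 0 .e ^ (n + 1)) v = 0) (he' : (g 1 .e ^ (n' + 1)) v = 0) (ξ ξ' : ℂ) (i : Fin 2)
    {a : Loc} (ha : a ≠ .x) (w : H n ⊗[ℂ] H n') :
    pairRaise q n n' (g 0 .e) (g 1 .e) v (tensorOp q r n n' ε ε' ξ ξ' i a w) =
      g i a (pairRaise q n n' (g 0 .e) (g 1 .e) v w) := by
  induction w with
  | zero => simp
  | add w w' h h' => simp only [map_add, h, h']
  | tmul x y =>
    have h0 : ∀ a, Commute (g 0 a) (raise q n' (g 1 .e) y) := fun a => commute_raise (h.comm _ _) y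
    fin_cases i
    · change pairRaise q n n' (g 0 .e) (g 1 .e) v (spinOp q r n ε ξ a x ⊗ₜ y) = g 0 a _
      rw [pairRaise_tmul, pairRaise_tmul]
      refine (h.local_rel 0).raise_intertwines hr hq0 hq ?_ ?_ ?_ ξ ha x
      · rw [← Module.End.mul_apply, (h0 _).eq, Module.End.mul_apply, hk, map_smul]
      · rw [← Module.End.mul_apply, (h0 _).eq, Module.End.mul_apply, hf, map_zero]
      · rw [← Module.End.mul_apply, ((h0 _).pow_left _).eq, Module.End.mul_apply, he, map_zero]
    · change pairRaise q n n' (g 0 .e) (g 1 .e) v (x ⊗ₜ spinOp q r n' ε' ξ' a y) = g 1 a _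
      have h1 : Commute (g 1 a) (raise q n (g 0 .e) x) := commute_raise (h.comm _ _).symm x
      rw [pairRaise_tmul, pairRaise_tmul,
        (h.local_rel 1).raise_intertwines hr hq0 hq hk' (hf 1) he' ξ' ha y,
        ← Module.End.mul_apply (g 1 a) (raise q n (g 0 .e) x), h1.eq, Module.End.mul_apply]

end LowestWeight

/-! ### Classification of the irreducible representations -/

section Classification

variable {q r : ℂ} {V : Type*} [AddCommGroup V] [Module ℂ V]

theorem intertwines_den {A B : Type*} [AddCommGroup A] [Module ℂ A] [AddCommGroup B] [Module ℂ B]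
    {g : Fin 2 → Loc → Module.End ℂ A} {g' : Fin 2 → Loc → Module.End ℂ B} {ψ : A →ₗ[ℂ] B}
    (h : ∀ i a, a ≠ .x → ∀ w, ψ (g i a w) = g' i a (ψ w)) (j : ℤ) (w : A) :
    ψ (denPlus q g j w) = denPlus q g' j (ψ w) ∧
      ψ (denMinus q g j w) = denMinus q g' j (ψ w) := by
  constructor <;>
  simp only [denPlus, denMinus, LinearMap.add_apply, LinearMap.smul_apply, Module.End.mul_apply,
    map_add, map_smul, ne_eq, reduceCtorEq, not_false_eq_true, h]

theorem intertwines_of_inverse {A B : Type*} [AddCommGroup A] [Module ℂ A] [AddCommGroup B]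
    [Module ℂ B] {D Z : Module.End ℂ A} {D' Z' : Module.End ℂ B} {ψ : A →ₗ[ℂ] B}
    (hZD : Z * D = 1) (hDZ' : D' * Z' = 1) (h : ∀ w, ψ (Z w) = Z' (ψ w)) (w : A) :
    ψ (D w) = D' (ψ w) := by
  have h1 := h (D w)
  rw [← Module.End.mul_apply, hZD, Module.End.one_apply] at h1
  rw [h1, ← Module.End.mul_apply, hDZ', Module.End.one_apply]

/-- A linear map that intertwines `e_i`, `f_i`, `q^(±H_i)` intertwines all generators except
possibly `x_i`. -/
theorem intertwines_gen {A B : Type*} [AddCommGroup A] [Module ℂ A] [AddCommGroup B] [Module ℂ B]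
    {T : UExt q →ₐ[ℂ] Module.End ℂ A} {ρ : UExt q →ₐ[ℂ] Module.End ℂ B} {ψ : A →ₗ[ℂ] B}
    (h : ∀ i a, a ≠ .x → ∀ w, ψ (copies T i a w) = copies ρ i a (ψ w)) {g : Gen}
    (hg : ∀ i, g ≠ .loc i .x) (w : A) : ψ (T (gen q g) w) = ρ (gen q g) (ψ w) := by
  cases g with
  | loc i a => exact h i a (fun ha => hg i (ha ▸ rfl)) w
  | dPlus j =>
    exact intertwines_of_inverse (mul_dPlus T j) (dPlus_mul ρ j)
      (fun w => (intertwines_den h j w).1) w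
  | dMinus j =>
    exact intertwines_of_inverse (mul_dMinus T j) (dMinus_mul ρ j)
      (fun w => (intertwines_den h j w).2) w

theorem exists_equiv_tensorRep [FiniteDimensional ℂ V] (hr : r ^ 2 = q) (hq0 : q ≠ 0)
    (hq : ∀ k : ℕ, 0 < k → q ^ k ≠ 1) (ρ : UExt q →ₐ[ℂ] Module.End ℂ V)
    (hρ : IsIrreducibleRep ρ) :
    ∃ (n n' : ℕ) (ε ε' : Eps), Admissible n n' ε ε' ∧
      ∃ T : UExt q →ₐ[ℂ] Module.End ℂ (H n ⊗[ℂ] H n'),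
        IsTensorRep q r n n' ε ε' (xVal r n ε) (xVal r n' ε') T ∧
        ∃ φ : V ≃ₗ[ℂ] H n ⊗[ℂ] H n',
          (∀ g : Gen, (∀ i : Fin 2, g ≠ Gen.loc i Loc.x) →
            ∀ v : V, φ (ρ (gen q g) v) = T (gen q g) (φ v)) ∧
          (∃ ξ ∈ xVals q r n ε, ∀ v : V, ρ (gen q (Gen.loc 0 Loc.x)) v = ξ • v) ∧
          (∃ ξ' ∈ xVals q r n' ε', ∀ v : V, ρ (gen q (Gen.loc 1 Loc.x)) v = ξ' • v) := by
  have hV : Nontrivial V := hρ.1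
  have hp := pairRel_copies ρ
  have hL := hp.local_rel
  obtain ⟨v, lam, hv0, hv⟩ := hp.exists_lowest hq0 hq
  have hlam : ∀ i, lam i ≠ 0 := fun i => (hL i).weight_ne_zero hv0 (hv i).1
  have hN : ∀ i, ∃ N, (copies ρ i .e ^ N) v ≠ 0 ∧ (copies ρ i .e ^ (N + 1)) v = 0 := fun i =>
    exists_pow_ne_zero_and_pow_succ_eq_zero hq0 hq (hL i).k_e (hlam i) hv0 (hv i).1
  choose N hN hN' using hN
  have hε : ∀ i, ∃ ε : Eps, lam i = ε.val * r ^ (-(N i : ℤ)) := fun i =>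
    (hL i).exists_eps hr hq0 hq (hlam i) (hv i).1 (hv i).2 (hN i) (hN' i)
  choose ε hε using hε
  have hk : ∀ i, copies ρ i .k v = ((ε i).val * r ^ (-(N i : ℤ))) • v := fun i =>
    hε i ▸ (hv i).1
  set ψ := pairRaise q (N 0) (N 1) (copies ρ 0 .e) (copies ρ 1 .e) v
  -- The source carries only the operators `tensorOp` for now: a representation of the extended
  -- algebra on it exists only after admissibility is proved.
  have hψ : ∀ i a, a ≠ .x → ∀ w, ψ (tensorOp q r (N 0) (N 1) (ε 0) (ε 1) (xVal r (N 0) (ε 0))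
      (xVal r (N 1) (ε 1)) i a w) = copies ρ i a (ψ w) := fun i a ha w =>
    hp.pairRaise_intertwines hr hq0 hq (hk 0) (hk 1) (fun i => (hv i).2) (hN' 0) (hN' 1) _ _ i ha w
  have hψ0 : ψ (spinVec (N 0) 0 ⊗ₜ spinVec (N 1) 0) = v := by
    simp [ψ, pairRaise_tmul, raise_spinVec]
  have hx : ∀ i, ∃ ξ ∈ xVals q r (N i) (ε i), ∀ v, copies ρ i .x v = ξ • v := fun i => by
    obtain ⟨ξ, hξ⟩ := exists_x_eq_smul ρ hρ i
    exact ⟨ξ, (hL i).x_mem_xVals hr hq0 hq hv0 (hk i) (hv i).2 hξ, hξ⟩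
  have hinj : LinearMap.ker ψ = ⊥ := by
    refine (tensorOp_irreducible (q := q) (r := r) (ε := ε 0) (ε' := ε 1) (ξ := xVal r (N 0) (ε 0))
      (ξ' := xVal r (N 1) (ε 1)) hq0 hq (fun i w hw => ?_) (fun i w hw => ?_)).resolve_right
        fun htop => ?_
    · rw [LinearMap.mem_ker] at hw ⊢
      rw [hψ i _ (by simp), hw, map_zero]
    · rw [LinearMap.mem_ker] at hw ⊢
      rw [hψ i _ (by simp), hw, map_zero]
    · rw [LinearMap.ker_eq_top] at htop
      rw [htop] at hψ0
      exact hv0 hψ0.symm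
  have hsurj : LinearMap.range ψ = ⊤ := by
    -- `ψ` need not intertwine `x_i`, but `x_i` acts on `V` by a scalar and so preserves the range.
    refine (hρ.2 _ (invariant_of_copies ρ fun i a => ?_)).resolve_left fun hbot => ?_
    · rintro _ ⟨w, rfl⟩
      by_cases ha : a = .x
      · obtain ⟨ξ, -, hξ⟩ := hx i
        exact ⟨ξ • w, by rw [ha, hξ, map_smul]⟩
      · exact ⟨_, hψ i a ha w⟩
    · rw [LinearMap.range_eq_bot] at hbot
      rw [hbot] at hψ0
      exact hv0 hψ0.symm
  have hadm : Admissible (N 0) (N 1) (ε 0) (ε 1) := by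
    by_contra hna
    -- A denominator that kills the lowest weight vector would, through `ψ`, kill `v`, although it
    -- has a left inverse on `V`.
    obtain ⟨j, hj⟩ := exists_denPlus_eq_zero (ξ := xVal r (N 0) (ε 0)) (ξ' := xVal r (N 1) (ε 1))
      hr hq0 hna
    have h1 := (intertwines_den (q := q) hψ j (spinVec (N 0) 0 ⊗ₜ spinVec (N 1) 0)).1
    rw [hj, map_zero, hψ0] at h1
    have hD := dPlus_mul ρ j
    have h2 := LinearMap.congr_fun hD v
    rw [Module.End.mul_apply, ← h1, map_zero] at h2
    exact hv0 h2.symm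
  obtain ⟨T, hT⟩ := exists_tensorRep (r := r) hr hq0 hq hadm (ξ := xVal r (N 0) (ε 0))
    (ξ' := xVal r (N 1) (ε 1)) (Or.inl rfl) (Or.inl rfl)
  rw [← isTensorRep_iff.mp hT] at hψ
  let e := LinearEquiv.ofBijective ψ ⟨LinearMap.ker_eq_bot.mp hinj, LinearMap.range_eq_top.mp hsurj⟩
  refine ⟨N 0, N 1, ε 0, ε 1, hadm, T, hT, e.symm, fun g hg v => ?_, hx 0, hx 1⟩
  rw [LinearEquiv.symm_apply_eq]
  refine Eq.trans ?_ (intertwines_gen hψ hg (e.symm v)).symm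
  exact congrArg _ (e.apply_symm_apply v).symm

end Classification

end QSl2

end

theorem theorem1 (q r : ℂ) (hr : r ^ 2 = q) (hq0 : q ≠ 0)
    (hq : ∀ k : ℕ, 0 < k → q ^ k ≠ 1) :
    (∀ (n n' : ℕ) (ε ε' : QSl2.Eps), QSl2.Admissible n n' ε ε' →
      ∀ ξ ∈ QSl2.xVals q r n ε, ∀ ξ' ∈ QSl2.xVals q r n' ε',
        ∃ T : QSl2.UExt q →ₐ[ℂ] Module.End ℂ (TensorProduct ℂ (QSl2.H n) (QSl2.H n')),
          QSl2.IsTensorRep q r n n' ε ε' ξ ξ' T ∧ QSl2.IsIrreducibleRep T ∧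
          ∀ T' : QSl2.UExt q →ₐ[ℂ] Module.End ℂ (TensorProduct ℂ (QSl2.H n) (QSl2.H n')),
            QSl2.IsTensorRep q r n n' ε ε' ξ ξ' T' → T' = T) ∧
    (∀ (n n' : ℕ) (ε ε' : QSl2.Eps), ¬ QSl2.Admissible n n' ε ε' →
      ∀ ξ ∈ QSl2.xVals q r n ε, ∀ ξ' ∈ QSl2.xVals q r n' ε',
        ¬ ∃ T : QSl2.UExt q →ₐ[ℂ] Module.End ℂ (TensorProduct ℂ (QSl2.H n) (QSl2.H n')),
          QSl2.IsTensorRep q r n n' ε ε' ξ ξ' T) ∧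
    (∀ (V : Type*) [AddCommGroup V] [Module ℂ V] [FiniteDimensional ℂ V]
      (ρ : QSl2.UExt q →ₐ[ℂ] Module.End ℂ V), QSl2.IsIrreducibleRep ρ →
      ∃ (n n' : ℕ) (ε ε' : QSl2.Eps), QSl2.Admissible n n' ε ε' ∧
        ∃ T : QSl2.UExt q →ₐ[ℂ] Module.End ℂ (TensorProduct ℂ (QSl2.H n) (QSl2.H n')),
          QSl2.IsTensorRep q r n n' ε ε' (QSl2.xVal r n ε) (QSl2.xVal r n' ε') T ∧
          ∃ φ : V ≃ₗ[ℂ] TensorProduct ℂ (QSl2.H n) (QSl2.H n'),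
            (∀ g : QSl2.Gen, (∀ i : Fin 2, g ≠ QSl2.Gen.loc i QSl2.Loc.x) →
              ∀ v : V, φ (ρ (QSl2.gen q g) v) = T (QSl2.gen q g) (φ v)) ∧
            (∃ ξ ∈ QSl2.xVals q r n ε, ∀ v : V,
              ρ (QSl2.gen q (QSl2.Gen.loc 0 QSl2.Loc.x)) v = ξ • v) ∧
            (∃ ξ' ∈ QSl2.xVals q r n' ε', ∀ v : V,
              ρ (QSl2.gen q (QSl2.Gen.loc 1 QSl2.Loc.x)) v = ξ' • v)) := by
  refine ⟨fun n n' ε ε' h ξ hξ ξ' hξ' => ?_, fun n n' ε ε' h ξ _ ξ' _ ⟨T, hT⟩ =>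
    h (hT.admissible hr hq0), fun V _ _ _ ρ hρ => QSl2.exists_equiv_tensorRep hr hq0 hq ρ hρ⟩
  obtain ⟨T, hT⟩ := QSl2.exists_tensorRep hr hq0 hq h hξ hξ'
  exact ⟨T, hT, hT.irreducible hq0 hq, fun T' hT' => hT.unique hT'⟩
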